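/- Let $n\ge 1$ and let $s_i=\sin\frac{i\pi}{2n+1}$. Let $X$ be the staircase model of the double $(2n+1)$-gon: the translation surface made of rectangles $R_1,\dots,R_{2n-1}$, where $R_i$ has width $s_{i+1}$ and height $s_i$ for odd $i$ and width $s_i$ and height $s_{i+1}$ for even $i$; $R_i$ and $R_{i+1}$ are glued along their sides of length $s_{i+1}$, each such side to the opposite side of the other rectangle, and the two remaining sides of $R_1$, and those of $R_{2n-1}$, are glued together; the corners are the singularities. The Veech group of $X$ is the group of derivatives of its orientation-preserving affine diffeomorphisms, and the trace field of $X$ is the subfield of $\mathbb R$ generated by the traces of the elements of the Veech group. An element $A\in SL_2(\mathbb R)$ is hyperbolic if $|\operatorname{tr}A|>2$. For $0\le i\le 2n$ let $D_i=\frac1{s_1}(s_{i+1},s_i)$; these are the rescaled diagonals of the rectangles, ordered by angle, together with $D_0=(1,0)$ and $D_{2n}=(0,1)$. For $0\le i\le 2n-1$ let $M_i\in SL_2(\mathbb R)$ be the matrix that maps $D_0$ to $D_i$ and $D_{2n}$ to $D_{i+1}$, and let $\Sigma_i$ be the subcone of the first quadrant between $D_i$ (included) and $D_{i+1}$ (excluded).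 The gcd algorithm replaces a direction (a line through the origin) lying in $\Sigma_i$ by its image under $M_i^{-1}$, and is then iterated. It is called eventually periodic for a direction if it does not terminate at the horizontal direction (which it fixes) and some direction obtained was already obtained at a previous step. Let $\theta$ be a direction in the open first quadrant (that is, with positive slope; in particular neither horizontal nor vertical) whose slope lies in the trace field of $X$. Then the following are equivalent: (i) the sequence of directions given by the gcd algorithm on $\theta$ is eventually periodic with minimal period at least $2$; (ii) the gcd algorithm is eventually periodic for $\theta$; (iii) $\theta$ is the image, under some (possibly empty) product $M_{i_k}\cdots M_{i_1}$, of an eigendirection of a hyperbolic matrix of the form $M_{j_1}\cdots M_{j_l}$. Moreover, every direction of positive slope (in the trace field or not) for which (i) or (ii) holds is fixed by a hyperbolic element of the Veech group of $X$. -/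

import Mathlib

open scoped LinearAlgebra.Projectivization MatrixGroups

noncomputable section

namespace DoublePolygon

/-! ### The staircase model of the double `(2n+1)`-gon -/

/-- The side lengths `sin (i π / (2n+1))`. -/
def side (n i : ℕ) : ℝ := Real.sin (i * Real.pi / (2 * n + 1))

/-- Width of the rectangle `R_i`, whose sides are `side n i` and `side n (i+1)`. Consecutive
rectangles are glued along sides of equal length, so the longer/shorter roles alternate. -/
def width (n i : ℕ) : ℝ := if Odd i then side n (i + 1) else side n i

/-- Height of the rectangle `R_i`. -/
def height (n i : ℕ) : ℝ := if Odd i then side n i else side n (i + 1)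

/-- The closed rectangle `R_i`, placed with its lower left corner at the origin. -/
def rect (n i : ℕ) : Set (Fin 2 → ℝ) :=
  {p | 0 ≤ p 0 ∧ p 0 ≤ width n i ∧ 0 ≤ p 1 ∧ p 1 ≤ height n i}

/-- The disjoint union of the closed rectangles `R_1, …, R_{2n-1}`. -/
abbrev RectPoint (n : ℕ) : Type := Σ i : Set.Icc 1 (2 * n - 1), rect n (i : ℕ)

/-- The vertical sides of `R_1` are glued together; `R_{2k}` and `R_{2k+1}` have the same height
and are glued along their vertical sides: `rightNbr i` is the index of the rectangle whose left
side is glued to the right side of `R_i`. -/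
def rightNbr (i : ℕ) : ℕ := if i = 1 then 1 else if Even i then i + 1 else i - 1

/-- `R_{2k-1}` and `R_{2k}` have the same width and are glued along their horizontal sides; the
horizontal sides of `R_{2n-1}` are glued together: `upNbr n i` is the index of the rectangle whose
bottom side is glued to the top side of `R_i`. -/
def upNbr (n i : ℕ) : ℕ := if i = 2 * n - 1 then i else if Odd i then i + 1 else i - 1

/-- The side identifications (all by translations). -/
def Glue (n : ℕ) (P Q : RectPoint n) : Prop :=
  ((Q.1 : ℕ) = rightNbr P.1 ∧ P.2.1 0 = width n P.1 ∧ Q.2.1 0 = 0 ∧ Q.2.1 1 = P.2.1 1) ∨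
  ((Q.1 : ℕ) = upNbr n P.1 ∧ P.2.1 1 = height n P.1 ∧ Q.2.1 1 = 0 ∧ Q.2.1 0 = P.2.1 0)

/-- The staircase surface, with the quotient topology. -/
abbrev Staircase (n : ℕ) : Type := Quot (Glue n)

/-- The singularities: the images of the corners of the rectangles. -/
def singularities (n : ℕ) : Set (Staircase n) :=
  {x | ∃ P : RectPoint n, (P.2.1 0 = 0 ∨ P.2.1 0 = width n P.1) ∧
    (P.2.1 1 = 0 ∨ P.2.1 1 = height n P.1) ∧ Quot.mk _ P = x}

/-- `Displaced x u y`: inside one of the closed rectangles, `y` is `x` translated by `u`.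
For a nonsingular `x` and all small `u` there is exactly one such `y`, and `u ↦ y` is the inverse
of the translation chart centred at `x`. -/
def Displaced {n : ℕ} (x : Staircase n) (u : Fin 2 → ℝ) (y : Staircase n) : Prop :=
  ∃ (i : Set.Icc 1 (2 * n - 1)) (p q : rect n (i : ℕ)),
    q.1 = p.1 + u ∧ (Quot.mk _ ⟨i, p⟩ : Staircase n) = x ∧ (Quot.mk _ ⟨i, q⟩ : Staircase n) = y

/-- `f` is an affine diffeomorphism of the staircase with derivative `A`: a homeomorphism that
preserves the set of singularities and that, in the translation charts around each nonsingular
point, has the form `u ↦ A u`. -/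
def IsAffineWithDerivative {n : ℕ} (f : Staircase n ≃ₜ Staircase n) (A : SL(2, ℝ)) : Prop :=
  (∀ x, f x ∈ singularities n ↔ x ∈ singularities n) ∧
  ∀ x, x ∉ singularities n → ∃ ε > 0, ∀ u : Fin 2 → ℝ, ‖u‖ < ε → ∀ y,
    Displaced x u y ↔ Displaced (f x) (A • u) (f y)

theorem exists_smul_small (A : SL(2, ℝ)) {ε : ℝ} (hε : 0 < ε) :
    ∃ δ > 0, ∀ u : Fin 2 → ℝ, ‖u‖ < δ → ‖A • u‖ < ε := by
  have hc : Continuous fun u : Fin 2 → ℝ => A • u := by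
    have : (fun u : Fin 2 → ℝ => A • u) = fun u => A.1.mulVec u := rfl
    rw [this]
    exact Continuous.matrix_mulVec continuous_const continuous_id
  have h := Metric.continuousAt_iff.1 (hc.continuousAt (x := (0 : Fin 2 → ℝ))) ε hε
  simpa [dist_eq_norm] using h

/-- The Veech group of the staircase: the group of all derivatives of affine diffeomorphisms. -/
def veechGroup (n : ℕ) : Subgroup SL(2, ℝ) where
  carrier := {A | ∃ f : Staircase n ≃ₜ Staircase n, IsAffineWithDerivative f A}
  one_mem' := ⟨Homeomorph.refl _, fun _ => Iff.rfl, fun x _ => ⟨1, one_pos, fun u _ y => by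
    simp⟩⟩
  mul_mem' := by
    rintro A B ⟨f, hf, hf'⟩ ⟨g, hg, hg'⟩
    refine ⟨g.trans f, fun x => (hf _).trans (hg _), fun x hx => ?_⟩
    obtain ⟨ε₁, h₁, H₁⟩ := hg' x hx
    obtain ⟨ε₂, h₂, H₂⟩ := hf' (g x) (fun h => hx ((hg x).1 h))
    obtain ⟨δ, hδ, H⟩ := exists_smul_small B h₂
    refine ⟨min ε₁ δ, lt_min h₁ hδ, fun u hu y => ?_⟩
    rw [H₁ u (hu.trans_le (min_le_left _ _)) y,
      H₂ _ (H u (hu.trans_le (min_le_right _ _))) (g y), mul_smul]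
    rfl
  inv_mem' := by
    rintro A ⟨f, hf, hf'⟩
    refine ⟨f.symm, fun x => by simpa using (hf (f.symm x)).symm, fun x hx => ?_⟩
    obtain ⟨ε, hε, H⟩ := hf' (f.symm x) (fun h => hx (by simpa using (hf (f.symm x)).2 h))
    obtain ⟨δ, hδ, H'⟩ := exists_smul_small A⁻¹ hε
    refine ⟨δ, hδ, fun u hu y => ?_⟩
    simpa using (H _ (H' u hu) (f.symm y)).symm

/-- The trace field of the staircase: the subfield of `ℝ` generated by the traces of the elements
of its Veech group. -/
def traceField (n : ℕ) : Subfield ℝ :=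
  Subfield.closure {t | ∃ A ∈ veechGroup n, t = A.1.trace}

/-- Hyperbolic elements of `SL(2, ℝ)`. -/
def IsHyperbolic (A : SL(2, ℝ)) : Prop := 2 < |A.1.trace|

/-! ### Directions and the gcd algorithm -/

/-- Directions in the plane, i.e. lines through the origin. The group `SL(2, ℝ)` acts on them,
and `A • θ = θ` means that `θ` is an eigendirection of `A`. -/
abbrev Direction : Type := ℙ ℝ (Fin 2 → ℝ)

/-- The direction `θ` has slope `t` (in particular it is not vertical). -/
def HasSlope (θ : Direction) (t : ℝ) : Prop := ![1, t] ∈ θ.submodule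

/-- The horizontal direction. -/
def horizontal : Direction := Projectivization.mk ℝ ![1, 0] (by simp)

/-- The diagonal vectors `D_0, …, D_{2n}`, in order of increasing angle and scaled so that
`D_0 = (1, 0)` and `D_{2n} = (0, 1)`. -/
def D (n i : ℕ) : Fin 2 → ℝ := ![side n (i + 1) / side n 1, side n i / side n 1]

theorem side_one_pos {n : ℕ} (hn : 0 < n) : 0 < side n 1 := by
  have h1 : (1 : ℝ) ≤ n := by exact_mod_cast hn
  refine Real.sin_pos_of_pos_of_lt_pi (by have := Real.pi_pos; positivity) ?_
  rw [div_lt_iff₀ (by positivity)]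
  push_cast
  nlinarith [Real.pi_pos]

theorem side_reflect {n i : ℕ} (hi : i ≤ 2 * n + 1) : side n (2 * n + 1 - i) = side n i := by
  have h : ((2 : ℝ) * n + 1) ≠ 0 := by positivity
  rw [side, side, Nat.cast_sub hi, ← Real.sin_pi_sub]
  congr 1
  push_cast
  field_simp
  ring

theorem D_zero {n : ℕ} (hn : 0 < n) : D n 0 = ![1, 0] := by
  simp [D, (side_one_pos hn).ne']
  simp [side]

theorem D_last {n : ℕ} (hn : 0 < n) : D n (2 * n) = ![0, 1] := by
  have h0 : side n (2 * n + 1) = 0 := by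
    have := side_reflect (n := n) (i := 0) (by omega)
    simpa [side] using this
  have h1 : side n (2 * n) = side n 1 := by
    simpa using side_reflect (n := n) (i := 1) (by omega)
  simp [D, h0, h1, (side_one_pos hn).ne']

/-- For odd `i`, `D_i` is the rescaled diagonal of the rectangle `R_i`. -/
theorem D_of_odd {n i : ℕ} (hn : 0 < n) (hi : Odd i) :
    side n 1 • D n i = ![width n i, height n i] := by
  have := (side_one_pos hn).ne'
  ext j
  fin_cases j <;> simp [D, width, height, hi] <;> field_simp

/-- For even `i`, `D_i` is the rescaled diagonal of the rectangle `R_{2n-i}`. -/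
theorem D_of_even {n i : ℕ} (hn : 0 < n) (hi : Even i) (h : i ≤ 2 * n) :
    side n 1 • D n i = ![width n (2 * n - i), height n (2 * n - i)] := by
  have h1 := (side_one_pos hn).ne'
  have h2 : ¬ Odd (2 * n - i) := by
    rw [Nat.not_odd_iff_even, Nat.even_sub h]
    simp [hi]
  have h3 : side n (2 * n - i) = side n (i + 1) := by
    rw [← side_reflect (n := n) (i := i + 1) (by omega)]
    congr 1
    omega
  have h4 : side n (2 * n - i + 1) = side n i := by
    rw [← side_reflect (n := n) (i := i) (by omega)]
    congr 1
    omega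
  ext j
  fin_cases j <;> simp [D, width, height, h2, h3, h4] <;> field_simp

theorem side_mul (n i : ℕ) :
    side n (i + 1) * side n (i + 1) - side n (i + 2) * side n i = side n 1 * side n 1 := by
  have h2 : side n (i + 2) = Real.sin ((i + 1 : ℕ) * Real.pi / (2 * n + 1)
      + (1 : ℕ) * Real.pi / (2 * n + 1)) := by
    rw [side]; congr 1; push_cast; ring
  have h0 : side n i = Real.sin ((i + 1 : ℕ) * Real.pi / (2 * n + 1)
      - (1 : ℕ) * Real.pi / (2 * n + 1)) := by
    rw [side]; congr 1; push_cast; ring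
  rw [h2, h0, Real.sin_add, Real.sin_sub]
  simp only [side]
  have ha := Real.sin_sq_add_cos_sq ((i + 1 : ℕ) * Real.pi / (2 * n + 1))
  have hb := Real.sin_sq_add_cos_sq ((1 : ℕ) * Real.pi / (2 * n + 1))
  generalize ((i + 1 : ℕ) * Real.pi / (2 * n + 1) : ℝ) = a at *
  generalize ((1 : ℕ) * Real.pi / (2 * n + 1) : ℝ) = b at *
  linear_combination Real.sin b ^ 2 * ha - Real.sin a ^ 2 * hb

/-- `M_i`, for `0 ≤ i ≤ 2n-1`, is the matrix with columns `D_i` and `D_{i+1}`: it maps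
`D_0 = (1, 0)` to `D_i` and `D_{2n} = (0, 1)` to `D_{i+1}`. -/
def M (n : ℕ) (i : Fin (2 * n)) : SL(2, ℝ) :=
  ⟨!![D n i 0, D n (i + 1) 0; D n i 1, D n (i + 1) 1], by
    have h := (side_one_pos (n := n) (by have := i.2; omega)).ne'
    have h' := side_mul n i
    simp only [D, Matrix.det_fin_two_of, Matrix.cons_val_zero, Matrix.cons_val_one]
    field_simp
    linarith⟩

/-- The `i`-th subcone `Σ_i` of the first quadrant, spanned by `D_i` (included) and `D_{i+1}`
(excluded), as a set of directions. -/
def subcone (n i : ℕ) : Set Direction :=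
  {θ | ∃ x y : ℝ, 0 < x ∧ 0 ≤ y ∧ x • D n i + y • D n (i + 1) ∈ θ.submodule}

open Classical in
/-- One step of the gcd algorithm: apply `M_i⁻¹` if the direction lies in the `i`-th subcone.
(Directions in no subcone are left unchanged.) -/
def gcdStep (n : ℕ) (θ : Direction) : Direction :=
  if h : ∃ i : Fin (2 * n), θ ∈ subcone n i then (M n h.choose)⁻¹ • θ else θ

/-- The gcd algorithm on `θ` does not terminate at the horizontal direction, and at some step
it gives a direction that was already obtained in a previous step. -/
def IsEventuallyPeriodic (n : ℕ) (θ : Direction) : Prop :=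
  ∃ k l, k < l ∧ (gcdStep n)^[l] θ = (gcdStep n)^[k] θ ∧ (gcdStep n)^[k] θ ≠ horizontal

/-- The sequence of directions given by the gcd algorithm on `θ` is eventually periodic,
with (minimal) period at least `2`. -/
def EndsWithPeriodGeTwo (n : ℕ) (θ : Direction) : Prop :=
  ∃ k, 2 ≤ Function.minimalPeriod (gcdStep n) ((gcdStep n)^[k] θ)

/-- The product `M_{i_1} ⋯ M_{i_k}` for the word `i_1, …, i_k`. -/
def wordProd (n : ℕ) (w : List (Fin (2 * n))) : SL(2, ℝ) := (w.map (M n)).prod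

/-- `θ` is the image, under a (possibly empty) product of matrices `M_i`, of an eigendirection of
a hyperbolic product of matrices `M_j`. -/
def IsImageOfHyperbolicEigendirection (n : ℕ) (θ : Direction) : Prop :=
  ∃ (I J : List (Fin (2 * n))) (η : Direction),
    IsHyperbolic (wordProd n J) ∧ wordProd n J • η = η ∧ θ = wordProd n I • η

end DoublePolygon

end

/-!
# Directions that are eventually periodic under the gcd algorithm

Write `N = 2n + 1` and `s_i = side n i`. Two identities carry the dynamics: the matrix `rot n`, of
order `N` on directions, maps `D_i` to `D_{i+1}`, and `M_i` is `rot n ^ (i + 1)` composed with a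
quarter turn (`M_eq`). The `M_i` cut the directions of slope in `[0, ∞)` into the `N - 1` subcones,
and the gcd algorithm is the common inverse of these branches (`gcdStep_M_smul`,
`exists_eq_M_smul`).

* If the algorithm is eventually periodic, reading off the branches writes the direction as the
  image under a product `W_I` of a fixed direction of a product `W_J`; since `W_J` has nonnegative
  entries and fixes a direction strictly inside the quadrant, it is hyperbolic
  (`exists_hyperbolic_of_isEventuallyPeriodic`).
* Conversely, let `η` be fixed by a hyperbolic product `W_J`. If `η` has positive slope, then the
  algorithm is periodic on `η`. Otherwise `η` is the contracting direction, and its image under the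
  quarter turn has positive slope and is fixed by another product of matrices `M_j`, because the
  quarter turn conjugates `M_i⁻¹` to `M_{2n-1-i}`. Eventual periodicity, up to the quarter turn, is
  preserved by all `M_i` (`isGood_or_isGood_quarterTurn_M_smul`): geometrically, the expansion of a
  direction is the cutting sequence of a geodesic ray through a tessellation by ideal `N`-gons, and
  the group generated by the `M_i` preserves the tessellation.
* A fixed point of the algorithm other than the horizontal direction has a slope `u` with
  `u² = s_i / s_{i+2}` and `0 < i < 2n - 1`. Under the Galois conjugation `ζ ↦ ζ ^ n` of the
  cyclotomic field the right-hand side becomes negative, so `u` is not in the real field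
  `sideField n` generated by `2 cos (π / N)` (`sq_mul_side_ne`). The trace field is contained in
  `sideField n`: an affine diffeomorphism maps closed straight paths to closed paths, and all
  holonomies have coordinates in `s_1 • sideField n` (`apply_mem_sideField`).
* All `M_i` lie in the Veech group, as `rot n` is the product of a horizontal shear and the quarter
  turn: rotating each rectangle `R_i` onto `R_{2n-i}` realizes the quarter turn
  (`quarterTurn_mem_veechGroup`), and simultaneous Dehn twists in the horizontal cylinders, which
  all have the same ratio of circumference to height, realize the shear (`shear_mem_veechGroup`).
-/

open scoped LinearAlgebra.Projectivization MatrixGroups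

noncomputable section

namespace DoublePolygon

/-! ### The side lengths and the rotation matrix -/

theorem side_zero (n : ℕ) : side n 0 = 0 := by simp [side]

theorem side_pos {n i : ℕ} (h0 : 0 < i) (hi : i < 2 * n + 1) : 0 < side n i := by
  have h1 : (1 : ℝ) ≤ i := by exact_mod_cast h0
  have h2 : (i : ℝ) < 2 * n + 1 := by exact_mod_cast hi
  refine Real.sin_pos_of_pos_of_lt_pi (by have := Real.pi_pos; positivity) ?_
  rw [div_lt_iff₀ (by positivity)]
  nlinarith [Real.pi_pos]

theorem side_nonneg {n i : ℕ} (hi : i ≤ 2 * n + 1) : 0 ≤ side n i := by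
  rcases Nat.eq_zero_or_pos i with rfl | h0
  · rw [side_zero]
  rcases hi.eq_or_lt with rfl | h
  · have := side_reflect (n := n) (i := 0) (by omega)
    rw [Nat.sub_zero] at this
    rw [this, side_zero]
  · exact (side_pos h0 h).le

theorem side_last (n : ℕ) : side n (2 * n + 1) = 0 := by
  have := side_reflect (n := n) (i := 0) (by omega)
  rwa [Nat.sub_zero, side_zero] at this

theorem side_add_half_turn (n i : ℕ) : side n (2 * n + 1 + i) = -side n i := by
  rw [side, side, ← Real.sin_add_pi]
  congr 1
  push_cast
  field_simp
  ring

theorem side_two_mul_self (n : ℕ) : side n (2 * n) = side n 1 := by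
  simpa using side_reflect (n := n) (i := 1) (by omega)

/-- The cross product of `D_i` and `D_{i+k}`, up to scaling. -/
theorem side_cross (n i k : ℕ) :
    side n (i + 1) * side n (i + k) - side n i * side n (i + k + 1) = side n 1 * side n k := by
  have e (a b : ℕ) : side n (a + b) = Real.sin (a * Real.pi / (2 * n + 1)) *
      Real.cos (b * Real.pi / (2 * n + 1)) + Real.cos (a * Real.pi / (2 * n + 1)) *
      Real.sin (b * Real.pi / (2 * n + 1)) := by
    rw [side, ← Real.sin_add]; congr 1; push_cast; ring
  rw [add_assoc, e i k, e i (k + 1), e i 1]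
  have h1 : side n (k + 1) = _ := e k 1
  have h2 : Real.cos ((k + 1 : ℕ) * Real.pi / (2 * n + 1)) =
      Real.cos (k * Real.pi / (2 * n + 1)) * Real.cos ((1 : ℕ) * Real.pi / (2 * n + 1)) -
      Real.sin (k * Real.pi / (2 * n + 1)) * Real.sin ((1 : ℕ) * Real.pi / (2 * n + 1)) := by
    rw [← Real.cos_add]; congr 1; push_cast; ring
  rw [h2]
  change Real.sin ((k + 1 : ℕ) * Real.pi / (2 * n + 1)) = _ at h1
  rw [h1]
  simp only [side]
  have ha := Real.sin_sq_add_cos_sq (i * Real.pi / (2 * n + 1))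
  generalize (i * Real.pi / (2 * n + 1) : ℝ) = a at *
  generalize (k * Real.pi / (2 * n + 1) : ℝ) = b at *
  generalize ((1 : ℕ) * Real.pi / (2 * n + 1) : ℝ) = c at *
  linear_combination (Real.sin b * Real.sin c) * ha

/-- The number `2 cos (π / (2n+1))`, written as a quotient of side lengths; it is the ratio
of circumference to height of every horizontal cylinder of the staircase. -/
def modulus (n : ℕ) : ℝ := side n 2 / side n 1

theorem side_add_two {n : ℕ} (hn : 0 < n) (i : ℕ) :
    side n (i + 2) = modulus n * side n (i + 1) - side n i := by
  have h1 := side_one_pos hn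
  have := side_cross n i 1
  have h2 := side_cross n 1 i
  rw [show 1 + i = i + 1 by ring] at h2
  rw [modulus, eq_sub_iff_add_eq]
  field_simp
  norm_num at h2
  linear_combination -h2

theorem side_one_le {n i : ℕ} (h0 : 0 < i) (hi : i < 2 * n + 1) : side n 1 ≤ side n i := by
  have hn : 0 < n := by omega
  obtain ⟨k, rfl⟩ : ∃ k, i = k + 1 := ⟨i - 1, by omega⟩
  have h1 := side_one_pos hn
  have hm := side_mul n k
  have ha := side_nonneg (n := n) (i := k + 2) (by omega)
  have hb := side_nonneg (n := n) (i := k) (by omega)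
  have hc := side_nonneg (n := n) (i := k + 1) (by omega)
  nlinarith [mul_nonneg ha hb]

/-- Rotation of the plane by a quarter turn. -/
def quarterTurn : SL(2, ℝ) := ⟨!![0, -1; 1, 0], by simp⟩

/-- The horizontal shear with coefficient `c`. -/
def shear (c : ℝ) : SL(2, ℝ) := ⟨!![1, c; 0, 1], by simp⟩

/-- The matrix that maps `D_i` to `D_{i+1}` for all `i`. It permutes the lines
spanned by `D_0, …, D_{2n}` cyclically. -/
def rot (n : ℕ) : SL(2, ℝ) := shear (modulus n) * quarterTurn

theorem coe_rot_pow {n : ℕ} (hn : 0 < n) (k : ℕ) : ((rot n ^ (k + 1) : SL(2, ℝ)).1) =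
    !![side n (k + 2) / side n 1, -(side n (k + 1) / side n 1);
      side n (k + 1) / side n 1, -(side n k / side n 1)] := by
  have h1 := (side_one_pos hn).ne'
  have hr : (rot n).1 = !![modulus n, -1; 1, 0] := by
    rw [rot, Matrix.SpecialLinearGroup.coe_mul]
    simp [shear, quarterTurn]
  induction k with
  | zero => simp [hr, modulus, side_zero, h1]
  | succ k ih =>
    rw [pow_succ', Matrix.SpecialLinearGroup.coe_mul, ih, hr]
    have e1 := side_add_two hn k
    have e2 := side_add_two hn (k + 1)
    rw [Matrix.mul_fin_two]
    congr 1
    ext i j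
    fin_cases i <;> fin_cases j <;> simp
    · rw [show k + 1 + 2 = k + 3 by ring] at *
      rw [e2]; ring
    · rw [show k + 1 + 1 = k + 2 by ring, e1]; ring

theorem M_eq {n : ℕ} (i : Fin (2 * n)) : M n i = rot n ^ ((i : ℕ) + 1) * quarterTurn⁻¹ := by
  have hn : 0 < n := by have := i.2; omega
  apply Subtype.ext
  rw [Matrix.SpecialLinearGroup.coe_mul, coe_rot_pow hn, Matrix.SpecialLinearGroup.coe_inv]
  simp [M, D, quarterTurn, Matrix.adjugate_fin_two_of]

theorem coe_rot_pow_card {n : ℕ} (hn : 0 < n) :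
    (rot n ^ (2 * n + 1) : SL(2, ℝ)).1 = !![-1, 0; 0, -1] := by
  have h1 := (side_one_pos hn).ne'
  rw [coe_rot_pow hn, side_last, side_two_mul_self, side_add_half_turn n 1]
  simp [h1]

/-! ### Directions given by their slope -/

/-- The direction of slope `t`. -/
def ofSlope (t : ℝ) : Direction := Projectivization.mk ℝ ![1, t] (by simp)

theorem mk_eq_ofSlope {v : Fin 2 → ℝ} (hv : v ≠ 0) {t : ℝ} (ht : v 1 = t * v 0) :
    Projectivization.mk ℝ v hv = ofSlope t := by
  rw [ofSlope, Projectivization.mk_eq_mk_iff']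
  refine ⟨v 0, ?_⟩
  ext j
  fin_cases j <;> simp [ht, mul_comm]

theorem hasSlope_iff {θ : Direction} {t : ℝ} : HasSlope θ t ↔ θ = ofSlope t := by
  constructor
  · intro h
    induction θ using Projectivization.ind with
    | h v hv =>
      rw [HasSlope, Projectivization.submodule_mk, Submodule.mem_span_singleton] at h
      obtain ⟨a, ha⟩ := h
      rw [ofSlope, eq_comm, Projectivization.mk_eq_mk_iff']
      exact ⟨a, ha⟩
  · rintro rfl
    rw [HasSlope, ofSlope, Projectivization.submodule_mk]
    exact Submodule.mem_span_singleton_self _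

theorem ofSlope_injective : Function.Injective ofSlope := by
  intro s t h
  rw [ofSlope, ofSlope, Projectivization.mk_eq_mk_iff'] at h
  obtain ⟨a, ha⟩ := h
  have h0 := congrFun ha 0
  have h1 := congrFun ha 1
  simp at h0 h1
  rw [← h1, h0, one_mul]

theorem sl_smul_eq (A : SL(2, ℝ)) (v : Fin 2 → ℝ) :
    A • v = ![A.1 0 0 * v 0 + A.1 0 1 * v 1, A.1 1 0 * v 0 + A.1 1 1 * v 1] := by
  change A.1.mulVec v = _
  ext j
  fin_cases j <;> simp [Matrix.mulVec, dotProduct]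

theorem smul_ofSlope (A : SL(2, ℝ)) {t u : ℝ}
    (hu : A.1 1 0 + A.1 1 1 * t = u * (A.1 0 0 + A.1 0 1 * t)) :
    A • ofSlope t = ofSlope u := by
  rw [ofSlope, Projectivization.smul_mk]
  apply mk_eq_ofSlope
  simpa [sl_smul_eq] using hu

/-- For `u = t` this says that the slope of a fixed direction is a root of a quadratic
polynomial. -/
theorem quadratic_of_smul_ofSlope_eq {A : SL(2, ℝ)} {t u : ℝ} (h : A • ofSlope t = ofSlope u) :
    A.1 1 0 + A.1 1 1 * t = u * (A.1 0 0 + A.1 0 1 * t) := by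
  rw [ofSlope, ofSlope, Projectivization.smul_mk, Projectivization.mk_eq_mk_iff'] at h
  obtain ⟨a, ha⟩ := h
  rw [sl_smul_eq] at ha
  have h0 := congrFun ha 0
  have h1 := congrFun ha 1
  simp at h0 h1
  rw [← h0, ← h1]
  ring

theorem eq_ofSlope_or_vertical (θ : Direction) :
    (∃ t, θ = ofSlope t) ∨ θ = Projectivization.mk ℝ ![0, 1] (by simp) := by
  induction θ using Projectivization.ind with
  | h v hv =>
    by_cases h : v 0 = 0
    · right
      rw [Projectivization.mk_eq_mk_iff']
      refine ⟨v 1, ?_⟩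
      ext j
      fin_cases j <;> simp [h]
    · left
      exact ⟨v 1 / v 0, mk_eq_ofSlope hv (by field_simp)⟩

theorem neg_one_smul_direction {A : SL(2, ℝ)} (hA : A.1 = !![-1, 0; 0, -1]) (θ : Direction) :
    A • θ = θ := by
  induction θ using Projectivization.ind with
  | h v hv =>
    rw [Projectivization.smul_mk, Projectivization.mk_eq_mk_iff']
    refine ⟨-1, ?_⟩
    rw [sl_smul_eq, hA]
    ext j
    fin_cases j <;> simp

theorem rot_pow_card_smul {n : ℕ} (hn : 0 < n) (θ : Direction) : rot n ^ (2 * n + 1) • θ = θ :=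
  neg_one_smul_direction (coe_rot_pow_card hn) θ

theorem quarterTurn_smul_smul (θ : Direction) : quarterTurn • quarterTurn • θ = θ := by
  rw [← mul_smul]
  exact neg_one_smul_direction (by
    rw [Matrix.SpecialLinearGroup.coe_mul]; simp [quarterTurn]) θ

theorem quarterTurn_inv_smul (θ : Direction) : quarterTurn⁻¹ • θ = quarterTurn • θ := by
  rw [inv_smul_eq_iff, quarterTurn_smul_smul]

/-! ### The gcd algorithm inverts the matrices `M_i` -/

theorem coe_M {n : ℕ} (i : Fin (2 * n)) : (M n i).1 =
    !![side n (i + 1) / side n 1, side n (i + 2) / side n 1;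
      side n i / side n 1, side n (i + 1) / side n 1] := rfl

theorem M_smul_mem_subcone {n : ℕ} (i : Fin (2 * n)) {t : ℝ} (ht : 0 ≤ t) :
    M n i • ofSlope t ∈ subcone n i := by
  refine ⟨1, t, one_pos, ht, ?_⟩
  rw [ofSlope, Projectivization.smul_mk, Projectivization.submodule_mk]
  convert Submodule.mem_span_singleton_self _ using 1
  rw [sl_smul_eq, coe_M]
  ext j
  fin_cases j <;> simp [D] <;> ring

theorem subcone_disjoint {n i j : ℕ} (hij : i < j) (hj : j < 2 * n) {θ : Direction}
    (h : θ ∈ subcone n i) : θ ∉ subcone n j := by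
  rintro ⟨x', y', hx', hy', h'⟩
  obtain ⟨x, y, hx, hy, h⟩ := h
  have h1 := side_one_pos (n := n) (by omega)
  induction θ using Projectivization.ind with
  | h v hv =>
  rw [Projectivization.submodule_mk, Submodule.mem_span_singleton] at h h'
  obtain ⟨a, ha⟩ := h
  obtain ⟨b, hb⟩ := h'
  have a0 := congrFun ha 0
  have a1 := congrFun ha 1
  have b0 := congrFun hb 0
  have b1 := congrFun hb 1
  simp only [D, Pi.smul_apply, Pi.add_apply, smul_eq_mul, Matrix.cons_val_zero,
    Matrix.cons_val_one] at a0 a1 b0 b1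
  have p1 := side_pos (n := n) (i := i + 1) (by omega) (by omega)
  have p2 := side_pos (n := n) (i := i + 2) (by omega) (by omega)
  have p3 := side_pos (n := n) (i := j + 1) (by omega) (by omega)
  have p4 := side_nonneg (n := n) (i := j + 2) (by omega)
  obtain ⟨k, rfl⟩ : ∃ k, j = i + 1 + k := ⟨j - i - 1, by omega⟩
  have q0 := side_cross n i 1
  have q1 := side_cross n (i + 1) k
  have q2 := side_cross n (i + 1) (k + 1)
  have r1 := side_nonneg (n := n) (i := k) (by omega)
  have r2 := side_pos (n := n) (i := k + 1) (by omega) (by omega)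
  have s0 : 0 < a * v 0 := by rw [a0]; positivity
  have s1 : 0 < b * v 0 := by rw [b0]; positivity
  have hab : 0 < a * b := by
    have : 0 < (a * b) * (v 0 * v 0) := by nlinarith [mul_pos s0 s1]
    by_contra hh
    nlinarith [mul_self_nonneg (v 0)]
  -- the cross product of `D_{i+1}` with the two vectors has opposite signs
  have c1 : side n (i + 1 + 1) * (a * v 1) - side n (i + 1) * (a * v 0) = -(x * side n 1) := by
    rw [a0, a1]; field_simp; simp only [add_assoc] at *; norm_num at *; linear_combination (-x) * q0
  have c2 : side n (i + 1 + 1) * (b * v 1) - side n (i + 1) * (b * v 0) =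
      x' * side n k + y' * side n (k + 1) := by
    rw [b0, b1]; field_simp; simp only [add_assoc] at *; linear_combination x' * q1 + y' * q2
  set w := side n (i + 1 + 1) * v 1 - side n (i + 1) * v 0
  have c1' : a * w < 0 := by
    have : 0 < x * side n 1 := by positivity
    simp only [w]; nlinarith
  have c2' : 0 ≤ b * w := by
    have : 0 ≤ x' * side n k + y' * side n (k + 1) := by positivity
    simp only [w]; nlinarith
  have hw : (a * w) * (b * w) ≤ 0 := mul_nonpos_of_nonpos_of_nonneg c1'.le c2'
  have hw0 : w ≠ 0 := by rintro h; simp [h] at c1'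
  have : 0 < (a * b) * (w * w) := mul_pos hab (mul_self_pos.2 hw0)
  linarith [show (a * w) * (b * w) = (a * b) * (w * w) by ring]

theorem subcone_index_unique {n : ℕ} {i j : Fin (2 * n)} {θ : Direction}
    (hi : θ ∈ subcone n i) (hj : θ ∈ subcone n j) : i = j := by
  rcases lt_trichotomy i j with h | h | h
  · exact absurd hj (subcone_disjoint h j.2 hi)
  · exact h
  · exact absurd hi (subcone_disjoint h i.2 hj)

theorem gcdStep_M_smul {n : ℕ} (i : Fin (2 * n)) {t : ℝ} (ht : 0 ≤ t) :
    gcdStep n (M n i • ofSlope t) = ofSlope t := by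
  have h : ∃ j : Fin (2 * n), M n i • ofSlope t ∈ subcone n j := ⟨i, M_smul_mem_subcone i ht⟩
  rw [gcdStep, dif_pos h, subcone_index_unique h.choose_spec (M_smul_mem_subcone i ht),
    inv_smul_smul]

theorem M_smul_ofSlope {n : ℕ} (i : Fin (2 * n)) {t : ℝ} (ht : 0 ≤ t) :
    ∃ u, 0 ≤ u ∧ (0 < t → 0 < u) ∧ M n i • ofSlope t = ofSlope u := by
  have h1 := side_one_pos (n := n) (by have := i.2; omega)
  have p1 := side_pos (n := n) (i := i + 1) (by omega) (by omega)
  have p0 := side_nonneg (n := n) (i := i) (by omega)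
  have p2 := side_nonneg (n := n) (i := i + 2) (by omega)
  have hd : 0 < side n (i + 1) / side n 1 + side n (i + 2) / side n 1 * t := by positivity
  refine ⟨(side n i / side n 1 + side n (i + 1) / side n 1 * t) /
    (side n (i + 1) / side n 1 + side n (i + 2) / side n 1 * t), by positivity,
    fun h => by positivity, ?_⟩
  apply smul_ofSlope
  simp [coe_M]
  field_simp

theorem exists_eq_M_smul {n : ℕ} (hn : 0 < n) {t : ℝ} (ht : 0 ≤ t) :
    ∃ (i : Fin (2 * n)) (u : ℝ), 0 ≤ u ∧ ofSlope t = M n i • ofSlope u := by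
  classical
  have h1 := side_one_pos hn
  -- `D_j` lies strictly above the direction of slope `t` for `j = 2n`
  have hex : ∃ j, side n (j + 1) * t < side n j := ⟨2 * n, by
    rw [side_last, side_two_mul_self]; simpa using h1⟩
  obtain ⟨j, hj⟩ : ∃ j, Nat.find hex = j := ⟨_, rfl⟩
  have hspec := Nat.find_spec hex
  have hle : Nat.find hex ≤ 2 * n := Nat.find_min' hex (by
    rw [side_last, side_two_mul_self]; simpa using h1)
  rw [hj] at hspec hle
  have hj0 : j ≠ 0 := by
    rintro rfl
    rw [side_zero] at hspec
    nlinarith [mul_nonneg h1.le ht]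
  obtain ⟨i, rfl⟩ := Nat.exists_eq_succ_of_ne_zero hj0
  have hmin := Nat.find_min hex (m := i) (by omega)
  rw [Nat.succ_eq_add_one] at *
  rw [not_lt] at hmin
  have hx : 0 < side n (i + 1) - side n (i + 2) * t := by linarith
  have p1 := side_pos (n := n) (i := i + 1) (by omega) (by omega)
  obtain ⟨u, hu⟩ : ∃ u, u = (side n (i + 1) * t - side n i) /
      (side n (i + 1) - side n (i + 2) * t) := ⟨_, rfl⟩
  have hu0 : 0 ≤ u := by rw [hu]; exact div_nonneg (by linarith) hx.le
  have hmul : u * (side n (i + 1) - side n (i + 2) * t) = side n (i + 1) * t - side n i := by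
    rw [hu, div_mul_cancel₀ _ hx.ne']
  have p2 := side_nonneg (n := n) (i := i + 2) (by omega)
  refine ⟨⟨i, by omega⟩, u, hu0, Eq.symm ?_⟩
  apply smul_ofSlope
  simp [coe_M]
  field_simp
  linear_combination hmul

/-! ### Eventually periodic directions -/

theorem gcdStep_horizontal {n : ℕ} (hn : 0 < n) : gcdStep n horizontal = horizontal := by
  have h : M n ⟨0, by omega⟩ • ofSlope 0 = ofSlope 0 := by
    apply smul_ofSlope
    simp [coe_M, side_zero]
  have h' := gcdStep_M_smul (n := n) ⟨0, by omega⟩ le_rfl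
  rwa [h] at h'

theorem iterate_gcdStep_horizontal {n : ℕ} (hn : 0 < n) (k : ℕ) :
    (gcdStep n)^[k] horizontal = horizontal :=
  Function.iterate_fixed (gcdStep_horizontal hn) k

theorem not_isEventuallyPeriodic_horizontal {n : ℕ} (hn : 0 < n) :
    ¬ IsEventuallyPeriodic n horizontal := by
  rintro ⟨k, l, -, -, h⟩
  exact h (iterate_gcdStep_horizontal hn k)

theorem isEventuallyPeriodic_gcdStep_iff {n : ℕ} (hn : 0 < n) {θ : Direction} :
    IsEventuallyPeriodic n (gcdStep n θ) ↔ IsEventuallyPeriodic n θ := by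
  constructor
  · rintro ⟨k, l, hkl, h, h'⟩
    exact ⟨k + 1, l + 1, by omega, h, h'⟩
  · rintro ⟨k, l, hkl, h, h'⟩
    refine ⟨k, l, hkl, ?_, fun h0 => h' ?_⟩
    · rw [← Function.iterate_succ_apply, ← Function.iterate_succ_apply,
        Function.iterate_succ_apply', Function.iterate_succ_apply', h]
    · rw [← h, show l = (l - (k + 1)) + (k + 1) by omega, Function.iterate_add_apply,
        Function.iterate_succ_apply, h0, iterate_gcdStep_horizontal hn]

theorem EndsWithPeriodGeTwo.isEventuallyPeriodic {n : ℕ} (hn : 0 < n) {θ : Direction}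
    (h : EndsWithPeriodGeTwo n θ) : IsEventuallyPeriodic n θ := by
  obtain ⟨k, hk⟩ := h
  refine ⟨k, Function.minimalPeriod (gcdStep n) ((gcdStep n)^[k] θ) + k, by omega, ?_, fun h => ?_⟩
  · rw [Function.iterate_add_apply, Function.iterate_minimalPeriod]
  · have h1 : Function.minimalPeriod (gcdStep n) ((gcdStep n)^[k] θ) = 1 :=
      Function.minimalPeriod_eq_one_iff_isFixedPt.2 (by rw [h]; exact gcdStep_horizontal hn)
    omega

theorem wordProd_cons {n : ℕ} (i : Fin (2 * n)) (w : List (Fin (2 * n))) :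
    wordProd n (i :: w) = M n i * wordProd n w := by simp [wordProd]

theorem wordProd_nil (n : ℕ) : wordProd n [] = 1 := by simp [wordProd]

/-- Running the gcd algorithm for `k` steps on a direction of slope in `[0, ∞)` writes it as the
image of such a direction under a product of `k` matrices. -/
theorem exists_eq_wordProd_smul_iterate {n : ℕ} (hn : 0 < n) (k : ℕ) {t : ℝ} (ht : 0 ≤ t) :
    ∃ (w : List (Fin (2 * n))) (u : ℝ), w.length = k ∧ 0 ≤ u ∧
      (gcdStep n)^[k] (ofSlope t) = ofSlope u ∧ ofSlope t = wordProd n w • ofSlope u := by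
  induction k generalizing t with
  | zero => exact ⟨[], t, rfl, ht, rfl, by rw [wordProd_nil, one_smul]⟩
  | succ k ih =>
    obtain ⟨i, t', ht', h⟩ := exists_eq_M_smul hn ht
    obtain ⟨w, u, hw, hu, h1, h2⟩ := ih ht'
    refine ⟨i :: w, u, by simp [hw], hu, ?_, ?_⟩
    · rw [Function.iterate_succ_apply, h, gcdStep_M_smul i ht', h1]
    · rw [h, h2, wordProd_cons, mul_smul]

/-! ### Nonnegative matrices -/

/-- The matrices with nonnegative entries and diagonal entries at least `1` whose only triangular
members are unipotent. They are closed under products and contain all `M_i`. -/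
structure IsQuadrantMap (A : SL(2, ℝ)) : Prop where
  diag_zero : 1 ≤ A.1 0 0
  diag_one : 1 ≤ A.1 1 1
  upper : 0 ≤ A.1 0 1
  lower : 0 ≤ A.1 1 0
  of_upper : A.1 0 1 = 0 → A.1 0 0 = 1 ∧ A.1 1 1 = 1
  of_lower : A.1 1 0 = 0 → A.1 0 0 = 1 ∧ A.1 1 1 = 1

theorem IsQuadrantMap.one : IsQuadrantMap 1 := by
  constructor <;> simp

theorem sl_mul_apply (A B : SL(2, ℝ)) (i j : Fin 2) :
    (A * B).1 i j = A.1 i 0 * B.1 0 j + A.1 i 1 * B.1 1 j := by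
  rw [Matrix.SpecialLinearGroup.coe_mul, Matrix.mul_apply, Fin.sum_univ_two]

theorem IsQuadrantMap.mul {A B : SL(2, ℝ)} (hA : IsQuadrantMap A) (hB : IsQuadrantMap B) :
    IsQuadrantMap (A * B) := by
  obtain ⟨a0, a1, a2, a3, a4, a5⟩ := hA
  obtain ⟨b0, b1, b2, b3, b4, b5⟩ := hB
  constructor <;> simp only [sl_mul_apply]
  · nlinarith [mul_nonneg a2 b3]
  · nlinarith [mul_nonneg a3 b2]
  · positivity
  · positivity
  · intro h
    have h1 : B.1 0 1 = 0 := by nlinarith [mul_nonneg a2 (zero_le_one.trans b1)]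
    have h2 : A.1 0 1 = 0 := by nlinarith [mul_nonneg b2 (zero_le_one.trans a0)]
    simp [h1, h2, a4 h2, b4 h1]
  · intro h
    have h1 : A.1 1 0 = 0 := by nlinarith [mul_nonneg b3 (zero_le_one.trans a1)]
    have h2 : B.1 1 0 = 0 := by nlinarith [mul_nonneg a3 (zero_le_one.trans b0)]
    simp [h1, h2, a5 h1, b5 h2]

theorem isQuadrantMap_M {n : ℕ} (i : Fin (2 * n)) : IsQuadrantMap (M n i) := by
  have h1 := side_one_pos (n := n) (by have := i.2; omega)
  have p0 := side_nonneg (n := n) (i := i) (by omega)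
  have p2 := side_nonneg (n := n) (i := i + 2) (by omega)
  have p1 := side_one_le (n := n) (i := i + 1) (by omega) (by omega)
  have hd : 1 ≤ side n (i + 1) / side n 1 := by rwa [le_div_iff₀ h1, one_mul]
  constructor <;> simp [coe_M]
  · exact hd
  · exact hd
  · positivity
  · positivity
  · rintro (h | h)
    · have : (i : ℕ) + 1 = 2 * n := by
        by_contra hne
        exact (side_pos (n := n) (i := i + 2) (by omega) (by omega)).ne' h
      rw [this, side_two_mul_self, div_self h1.ne']
    · exact absurd h h1.ne'
  · rintro (h | h)
    · have : (i : ℕ) = 0 := by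
        by_contra hne
        exact (side_pos (n := n) (i := i) (by omega) (by omega)).ne' h
      rw [this, zero_add, div_self h1.ne']
    · exact absurd h h1.ne'

theorem isQuadrantMap_wordProd {n : ℕ} (w : List (Fin (2 * n))) :
    IsQuadrantMap (wordProd n w) := by
  induction w with
  | nil => rw [wordProd_nil]; exact .one
  | cons i w ih => rw [wordProd_cons]; exact (isQuadrantMap_M i).mul ih

theorem wordProd_off_diagonal_pos {n : ℕ} {w : List (Fin (2 * n))} (hw : w ≠ []) :
    0 < (wordProd n w).1 0 1 + (wordProd n w).1 1 0 := by
  obtain ⟨i, w, rfl⟩ := List.exists_cons_of_ne_nil hw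
  have h1 := side_one_pos (n := n) (by have := i.2; omega)
  have hM := isQuadrantMap_M i
  have hB := isQuadrantMap_wordProd w
  rw [wordProd_cons, sl_mul_apply, sl_mul_apply]
  have hoff : 0 < (M n i).1 0 1 + (M n i).1 1 0 := by
    simp only [coe_M]
    simp
    have p0 := side_nonneg (n := n) (i := i) (by omega)
    have p2 := side_nonneg (n := n) (i := i + 2) (by omega)
    rw [← add_div]
    refine div_pos ?_ h1
    rcases Nat.eq_zero_or_pos (i : ℕ) with h | h
    · have := side_pos (n := n) (i := i + 2) (by omega) (by omega)
      linarith
    · have := side_pos (n := n) (i := i) h (by omega)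
      linarith
  nlinarith [mul_nonneg (zero_le_one.trans hM.diag_zero) hB.upper,
    mul_nonneg (zero_le_one.trans hM.diag_one) hB.lower,
    mul_nonneg hM.upper (sub_nonneg.2 hB.diag_one), mul_nonneg hM.lower (sub_nonneg.2 hB.diag_zero)]

theorem trace_eq (A : SL(2, ℝ)) : A.1.trace = A.1 0 0 + A.1 1 1 := Matrix.trace_fin_two _

/-- A nonempty product of matrices `M_i` that fixes a direction strictly inside the first
quadrant is hyperbolic. -/
theorem isHyperbolic_wordProd {n : ℕ} {w : List (Fin (2 * n))} (hw : w ≠ []) {t : ℝ} (ht : 0 < t)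
    (h : wordProd n w • ofSlope t = ofSlope t) : IsHyperbolic (wordProd n w) := by
  have hA := isQuadrantMap_wordProd w
  have hoff := wordProd_off_diagonal_pos hw
  have hq := quadratic_of_smul_ofSlope_eq h
  have hd := (wordProd n w).det_coe
  rw [Matrix.det_fin_two] at hd
  generalize wordProd n w = A at *
  rw [IsHyperbolic, trace_eq]
  refine lt_of_lt_of_le (lt_of_not_ge fun hle => ?_) (le_abs_self _)
  have e0 : A.1 0 0 = 1 := by linarith [hA.diag_zero, hA.diag_one]
  have e1 : A.1 1 1 = 1 := by linarith [hA.diag_zero, hA.diag_one]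
  rw [e0, e1] at hq hd
  have hbc : A.1 0 1 * A.1 1 0 = 0 := by linarith
  rcases mul_eq_zero.1 hbc with hb | hc
  · rw [hb] at hq hoff; linarith
  · rw [hc] at hq hoff
    nlinarith [mul_pos ht ht]

/-- A hyperbolic product of matrices `M_i` does not fix the horizontal or vertical direction. -/
theorem slope_of_smul_eq_of_isHyperbolic {n : ℕ} {w : List (Fin (2 * n))}
    (hw : IsHyperbolic (wordProd n w)) {η : Direction} (h : wordProd n w • η = η) :
    ∃ t, t ≠ 0 ∧ η = ofSlope t := by
  have hA := isQuadrantMap_wordProd w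
  generalize wordProd n w = A at *
  rw [IsHyperbolic, trace_eq] at hw
  rcases eq_ofSlope_or_vertical η with ⟨t, rfl⟩ | rfl
  · refine ⟨t, ?_, rfl⟩
    rintro rfl
    have hq := quadratic_of_smul_ofSlope_eq h
    obtain ⟨e0, e1⟩ := hA.of_lower (by linarith)
    rw [e0, e1] at hw
    norm_num at hw
  · exfalso
    rw [Projectivization.smul_mk, Projectivization.mk_eq_mk_iff'] at h
    obtain ⟨a, ha⟩ := h
    rw [sl_smul_eq] at ha
    have h0 := congrFun ha 0
    simp at h0
    obtain ⟨e0, e1⟩ := hA.of_upper h0.symm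
    rw [e0, e1] at hw
    norm_num at hw

/-! ### Eventually periodic directions and hyperbolic products -/

theorem exists_hyperbolic_of_isEventuallyPeriodic {n : ℕ} (hn : 0 < n) {t : ℝ} (ht : 0 ≤ t)
    (h : IsEventuallyPeriodic n (ofSlope t)) :
    IsImageOfHyperbolicEigendirection n (ofSlope t) := by
  obtain ⟨k, l, hkl, h, h'⟩ := h
  obtain ⟨I, u, -, hu, e1, e2⟩ := exists_eq_wordProd_smul_iterate hn k ht
  obtain ⟨J, v, hJ, hv, e3, e4⟩ := exists_eq_wordProd_smul_iterate hn (l - k) hu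
  rw [← e1, ← Function.iterate_add_apply, show l - k + k = l by omega, h, e1] at e3
  rw [← e3] at e4
  have hu0 : u ≠ 0 := by
    rintro rfl
    exact h' e1
  refine ⟨I, J, ofSlope u, isHyperbolic_wordProd ?_ (lt_of_le_of_ne hu hu0.symm) e4.symm,
    e4.symm, e2⟩
  rintro rfl
  simp at hJ
  omega

/-- The directions strictly inside the first quadrant for which the gcd algorithm is eventually
periodic. -/
def IsGood (n : ℕ) (θ : Direction) : Prop :=
  ∃ t, 0 < t ∧ θ = ofSlope t ∧ IsEventuallyPeriodic n θ

theorem IsGood.M_smul {n : ℕ} {θ : Direction} (h : IsGood n θ) (i : Fin (2 * n)) :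
    IsGood n (M n i • θ) := by
  have hn : 0 < n := by have := i.2; omega
  obtain ⟨t, ht, rfl, h⟩ := h
  obtain ⟨u, -, hu, e⟩ := M_smul_ofSlope i ht.le
  refine ⟨u, hu ht, e, ?_⟩
  rwa [← isEventuallyPeriodic_gcdStep_iff hn, gcdStep_M_smul i ht.le]

theorem IsGood.exists_eq_M_smul {n : ℕ} (hn : 0 < n) {θ : Direction} (h : IsGood n θ) :
    ∃ i η, IsGood n η ∧ θ = M n i • η := by
  obtain ⟨t, ht, rfl, h⟩ := h
  obtain ⟨i, u, hu, e⟩ := DoublePolygon.exists_eq_M_smul hn ht.le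
  rw [← isEventuallyPeriodic_gcdStep_iff hn, e, gcdStep_M_smul i hu] at h
  refine ⟨i, ofSlope u, ⟨u, lt_of_le_of_ne hu ?_, rfl, h⟩, e⟩
  rintro rfl
  exact not_isEventuallyPeriodic_horizontal hn h

theorem M_smul {n : ℕ} (i : Fin (2 * n)) (θ : Direction) :
    M n i • θ = rot n ^ ((i : ℕ) + 1) • quarterTurn • θ := by
  rw [M_eq, mul_smul, quarterTurn_inv_smul]

/-- Up to the quarter turn that exchanges the two sides of the edge from `D_0` to `D_{2n}`, the
matrices `M_i` preserve the set of directions with an eventually periodic expansion, even if they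
do not have positive slope. The reason is that `M_i`, the quarter turn and `M_j` compose to the
quarter turn followed by a rotation of the ideal polygon with vertices `D_0, …, D_{2n}`. -/
theorem isGood_or_isGood_quarterTurn_M_smul {n : ℕ} {θ : Direction} (i : Fin (2 * n))
    (h : IsGood n θ ∨ IsGood n (quarterTurn • θ)) :
    IsGood n (M n i • θ) ∨ IsGood n (quarterTurn • M n i • θ) := by
  have hn : 0 < n := by have := i.2; omega
  rcases h with h | h
  · exact Or.inl (h.M_smul i)
  obtain ⟨j, η, hη, e⟩ := h.exists_eq_M_smul hn
  have e2 : M n i • θ = rot n ^ ((i : ℕ) + j + 2) • quarterTurn • η := by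
    rw [M_smul, e, M_smul, ← mul_smul, ← pow_add]
    congr 2
    ring
  rcases lt_trichotomy ((i : ℕ) + j + 2) (2 * n + 1) with hlt | heq | hgt
  · left
    have := hη.M_smul ⟨(i : ℕ) + j + 1, by omega⟩
    rwa [M_smul, ← e2] at this
  · right
    rw [e2, heq, rot_pow_card_smul hn, quarterTurn_smul_smul]
    exact hη
  · left
    have := hη.M_smul ⟨(i : ℕ) + j + 2 - (2 * n + 1) - 1, by omega⟩
    rw [M_smul] at this
    rwa [e2, show (i : ℕ) + j + 2 = ((i : ℕ) + j + 2 - (2 * n + 1) - 1 + 1) + (2 * n + 1) by omega,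
      pow_add, mul_smul, rot_pow_card_smul hn]

theorem isGood_or_isGood_quarterTurn_wordProd_smul {n : ℕ} {θ : Direction}
    (w : List (Fin (2 * n))) (h : IsGood n θ ∨ IsGood n (quarterTurn • θ)) :
    IsGood n (wordProd n w • θ) ∨ IsGood n (quarterTurn • wordProd n w • θ) := by
  induction w with
  | nil => rwa [wordProd_nil, one_smul]
  | cons i w ih =>
    rw [wordProd_cons, mul_smul]
    exact isGood_or_isGood_quarterTurn_M_smul i ih

theorem isGood_of_wordProd_smul_eq {n : ℕ} {w : List (Fin (2 * n))} (hw : w ≠ [])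
    {t : ℝ} (ht : 0 < t) (h : wordProd n w • ofSlope t = ofSlope t) :
    IsGood n (ofSlope t) := by
  refine ⟨t, ht, rfl, 0, w.length, List.length_pos_iff.2 hw, ?_, fun h0 => ht.ne' ?_⟩
  · -- the algorithm strips off the letters of the word one by one
    have key : ∀ v : List (Fin (2 * n)), (∃ u, 0 ≤ u ∧ wordProd n v • ofSlope t = ofSlope u) ∧
        (gcdStep n)^[v.length] (wordProd n v • ofSlope t) = ofSlope t := by
      intro v
      induction v with
      | nil =>
        rw [wordProd_nil, one_smul]
        exact ⟨⟨t, ht.le, rfl⟩, rfl⟩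
      | cons i v ih =>
        obtain ⟨⟨u, hu, e⟩, ih⟩ := ih
        rw [wordProd_cons, mul_smul, List.length_cons, Function.iterate_succ_apply]
        obtain ⟨u', hu', -, e'⟩ := M_smul_ofSlope i hu
        refine ⟨⟨u', hu', by rw [e, e']⟩, ?_⟩
        rw [e, gcdStep_M_smul i hu, ← e, ih]
    have := (key w).2
    rwa [h] at this
  · exact ofSlope_injective h0

/-- Conjugation by the quarter turn maps the inverse of `M_i` to `M_{2n-1-i}`. -/
theorem quarterTurn_smul_M_inv_smul {n : ℕ} (i : Fin (2 * n)) (θ : Direction) :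
    quarterTurn • (M n i)⁻¹ • θ = M n i.rev • quarterTurn • θ := by
  have hn : 0 < n := by have := i.2; omega
  obtain ⟨η, rfl⟩ : ∃ η, θ = M n i • η := ⟨(M n i)⁻¹ • θ, by rw [smul_inv_smul]⟩
  rw [inv_smul_smul, M_smul, quarterTurn_smul_smul, M_smul, ← mul_smul, ← pow_add, Fin.val_rev,
    show 2 * n - ((i : ℕ) + 1) + 1 + (i + 1) = 2 * n + 1 by omega, rot_pow_card_smul hn]

theorem quarterTurn_smul_wordProd_inv_smul {n : ℕ} (w : List (Fin (2 * n))) (θ : Direction) :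
    quarterTurn • (wordProd n w)⁻¹ • θ = wordProd n (w.map Fin.rev).reverse • quarterTurn • θ := by
  induction w generalizing θ with
  | nil => simp [wordProd_nil]
  | cons i w ih =>
    rw [wordProd_cons, mul_inv_rev, mul_smul, ih, quarterTurn_smul_M_inv_smul]
    simp [wordProd, mul_smul]

theorem IsImageOfHyperbolicEigendirection.isEventuallyPeriodic {n : ℕ} {t : ℝ}
    (ht : 0 < t) (h : IsImageOfHyperbolicEigendirection n (ofSlope t)) :
    IsEventuallyPeriodic n (ofSlope t) := by
  obtain ⟨I, J, η, hJ, hη, e⟩ := h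
  have hJ0 : J ≠ [] := by
    rintro rfl
    rw [wordProd_nil, IsHyperbolic, trace_eq] at hJ
    norm_num at hJ
  have hP : IsGood n η ∨ IsGood n (quarterTurn • η) := by
    obtain ⟨u, hu, rfl⟩ := slope_of_smul_eq_of_isHyperbolic hJ hη
    rcases hu.lt_or_gt with hu | hu
    · right
      have e1 : quarterTurn • ofSlope u = ofSlope (-u⁻¹) := by
        apply smul_ofSlope
        simp [quarterTurn, hu.ne]
      have e2 : (wordProd n J)⁻¹ • ofSlope u = ofSlope u := by rw [inv_smul_eq_iff, hη]
      have e3 := quarterTurn_smul_wordProd_inv_smul J (ofSlope u)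
      rw [e2, e1] at e3
      rw [e1]
      refine isGood_of_wordProd_smul_eq (by simpa using hJ0) ?_ e3.symm
      simpa using hu
    · exact Or.inl (isGood_of_wordProd_smul_eq hJ0 hu hη)
  rcases isGood_or_isGood_quarterTurn_wordProd_smul I hP with h | h <;> rw [← e] at h
  · obtain ⟨_, _, _, h⟩ := h
    exact h
  · -- the quarter turn of a direction of positive slope has negative slope
    exfalso
    obtain ⟨s, hs, hs', -⟩ := h
    have hq := quadratic_of_smul_ofSlope_eq hs'
    simp [quarterTurn] at hq
    nlinarith [mul_pos hs ht]

open Filter Topology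

/-! ### Combinatorics of the staircase -/

theorem width_pos {n i : ℕ} (h : i ∈ Set.Icc 1 (2 * n - 1)) : 0 < width n i := by
  obtain ⟨h1, h2⟩ := h
  rw [width]
  split_ifs <;> exact side_pos (by omega) (by omega)

theorem height_pos {n i : ℕ} (h : i ∈ Set.Icc 1 (2 * n - 1)) : 0 < height n i := by
  obtain ⟨h1, h2⟩ := h
  rw [height]
  split_ifs <;> exact side_pos (by omega) (by omega)

theorem rightNbr_mem {n i : ℕ} (h : i ∈ Set.Icc 1 (2 * n - 1)) :
    rightNbr i ∈ Set.Icc 1 (2 * n - 1) := by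
  simp only [rightNbr, Set.mem_Icc, Nat.even_iff] at *
  split_ifs <;> omega

theorem upNbr_mem {n i : ℕ} (h : i ∈ Set.Icc 1 (2 * n - 1)) :
    upNbr n i ∈ Set.Icc 1 (2 * n - 1) := by
  simp only [upNbr, Set.mem_Icc, Nat.odd_iff] at *
  split_ifs <;> omega

theorem rightNbr_rightNbr {n i : ℕ} (h : i ∈ Set.Icc 1 (2 * n - 1)) :
    rightNbr (rightNbr i) = i := by
  simp only [rightNbr, Set.mem_Icc, Nat.even_iff] at *
  split_ifs <;> omega

theorem upNbr_upNbr {n i : ℕ} (h : i ∈ Set.Icc 1 (2 * n - 1)) :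
    upNbr n (upNbr n i) = i := by
  simp only [upNbr, Set.mem_Icc, Nat.odd_iff] at *
  split_ifs <;> omega

theorem height_rightNbr {n i : ℕ} (h : i ∈ Set.Icc 1 (2 * n - 1)) :
    height n (rightNbr i) = height n i := by
  obtain ⟨h1, -⟩ := h
  simp only [rightNbr, height, Nat.even_iff, Nat.odd_iff]
  split_ifs <;> first | rfl | omega | (congr 1; done) | (congr 1; omega)

theorem width_upNbr {n i : ℕ} (h : i ∈ Set.Icc 1 (2 * n - 1)) :
    width n (upNbr n i) = width n i := by
  obtain ⟨h1, h2⟩ := h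
  simp only [upNbr, width, Nat.odd_iff]
  split_ifs <;> first | rfl | omega | (congr 1; done) | (congr 1; omega)

theorem width_reflect {n i : ℕ} (h : i ∈ Set.Icc 1 (2 * n - 1)) :
    width n (2 * n - i) = height n i := by
  obtain ⟨h1, h2⟩ := h
  have e1 : side n (2 * n - i) = side n (i + 1) := by
    rw [← side_reflect (n := n) (i := i + 1) (by omega)]; congr 1; omega
  have e2 : side n (2 * n - i + 1) = side n i := by
    rw [← side_reflect (n := n) (i := i) (by omega)]; congr 1; omega
  simp only [width, height, Nat.odd_iff, e1, e2]
  split_ifs <;> first | rfl | omega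

theorem height_reflect {n i : ℕ} (h : i ∈ Set.Icc 1 (2 * n - 1)) :
    height n (2 * n - i) = width n i := by
  obtain ⟨h1, h2⟩ := h
  rw [← width_reflect (by simp only [Set.mem_Icc]; omega)]
  congr 1
  omega

theorem upNbr_reflect {n i : ℕ} (h : i ∈ Set.Icc 1 (2 * n - 1)) :
    upNbr n (2 * n - i) = 2 * n - rightNbr i := by
  simp only [upNbr, rightNbr, Set.mem_Icc, Nat.odd_iff, Nat.even_iff] at *
  split_ifs <;> omega

theorem rightNbr_reflect {n i : ℕ} (h : i ∈ Set.Icc 1 (2 * n - 1)) :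
    rightNbr (2 * n - i) = 2 * n - upNbr n i := by
  simp only [upNbr, rightNbr, Set.mem_Icc, Nat.odd_iff, Nat.even_iff] at *
  split_ifs <;> omega

/-- The circumference of a horizontal cylinder made of two rectangles. -/
theorem modulus_mul_height {n i : ℕ} (h : i ∈ Set.Icc 1 (2 * n - 1)) (hi : i ≠ 1) :
    modulus n * height n i = width n i + width n (rightNbr i) := by
  obtain ⟨h1, h2⟩ := h
  have hn : 0 < n := by omega
  have e0 := side_add_two hn i
  obtain ⟨j, rfl⟩ : ∃ j, i = j + 1 := ⟨i - 1, by omega⟩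
  have e1 := side_add_two hn j
  simp only [rightNbr, height, width, Nat.even_iff, Nat.odd_iff, if_neg hi]
  split_ifs <;> try omega
  · rw [Nat.add_sub_cancel]
    linarith
  · linarith

theorem modulus_mul_height_one {n : ℕ} (hn : 0 < n) :
    modulus n * height n 1 = width n 1 := by
  simp [modulus, height, width, (side_one_pos hn).ne']

/-! ### Fibres of the quotient map -/

theorem RectPoint.ext {n : ℕ} {P Q : RectPoint n} (h : (P.1 : ℕ) = Q.1) (h0 : P.2.1 0 = Q.2.1 0)
    (h1 : P.2.1 1 = Q.2.1 1) : P = Q := by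
  obtain ⟨i, p, hp⟩ := P
  obtain ⟨j, q, hq⟩ := Q
  obtain rfl : i = j := Subtype.ext h
  have : p = q := by
    ext k
    fin_cases k
    · exact h0
    · exact h1
  subst this
  rfl

/-- A point of the disjoint union of the rectangles is a corner of its rectangle. -/
def IsCorner {n : ℕ} (P : RectPoint n) : Prop :=
  (P.2.1 0 = 0 ∨ P.2.1 0 = width n P.1) ∧ (P.2.1 1 = 0 ∨ P.2.1 1 = height n P.1)

theorem Glue.isCorner_iff {n : ℕ} {P Q : RectPoint n} (h : Glue n P Q) :
    IsCorner P ↔ IsCorner Q := by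
  rcases h with ⟨h1, h2, h3, h4⟩ | ⟨h1, h2, h3, h4⟩
  · simp [IsCorner, h2, h3, h4, h1, height_rightNbr P.1.2]
  · simp [IsCorner, h2, h3, h4, h1, width_upNbr P.1.2]

theorem mk_mem_singularities {n : ℕ} {P : RectPoint n} :
    (Quot.mk _ P : Staircase n) ∈ singularities n ↔ IsCorner P := by
  constructor
  · rintro ⟨Q, hQ, hQ', e⟩
    have : IsCorner Q = IsCorner P := congrArg (Quot.lift (r := Glue n) IsCorner fun _ _ h =>
      propext h.isCorner_iff) e
    exact this.mp ⟨hQ, hQ'⟩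
  · rintro ⟨h, h'⟩
    exact ⟨P, h, h', rfl⟩

theorem Glue.not_glue {n : ℕ} {P Q R : RectPoint n} (hQ : ¬ IsCorner Q) (h : Glue n P Q) :
    ¬ Glue n Q R := by
  intro h'
  have hw := width_pos Q.1.2
  have hh := height_pos Q.1.2
  rcases h with ⟨-, -, h3, -⟩ | ⟨-, -, h3, -⟩ <;>
    rcases h' with ⟨-, h6, -, -⟩ | ⟨-, h6, -, -⟩
  · linarith
  · exact hQ ⟨Or.inl h3, Or.inr h6⟩
  · exact hQ ⟨Or.inr h6, Or.inl h3⟩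
  · linarith

theorem Glue.target_unique {n : ℕ} {P Q R : RectPoint n} (hP : ¬ IsCorner P) (h : Glue n P Q)
    (h' : Glue n P R) : Q = R := by
  rcases h with ⟨h1, h2, h3, h4⟩ | ⟨h1, h2, h3, h4⟩ <;>
    rcases h' with ⟨h5, h6, h7, h8⟩ | ⟨h5, h6, h7, h8⟩
  · exact RectPoint.ext (h1.trans h5.symm) (h3.trans h7.symm) (h4.trans h8.symm)
  · exact absurd ⟨Or.inr h2, Or.inr h6⟩ hP
  · exact absurd ⟨Or.inr h6, Or.inr h2⟩ hP
  · exact RectPoint.ext (h1.trans h5.symm) (h4.trans h8.symm) (h3.trans h7.symm)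

theorem Glue.source_unique {n : ℕ} {P Q R : RectPoint n} (hP : ¬ IsCorner P) (h : Glue n Q P)
    (h' : Glue n R P) : Q = R := by
  rcases h with ⟨h1, h2, h3, h4⟩ | ⟨h1, h2, h3, h4⟩ <;>
    rcases h' with ⟨h5, h6, h7, h8⟩ | ⟨h5, h6, h7, h8⟩
  · have e : (Q.1 : ℕ) = R.1 := by
      rw [← rightNbr_rightNbr Q.1.2, ← h1, h5, rightNbr_rightNbr R.1.2]
    exact RectPoint.ext e (by rw [h2, h6, e]) (by rw [← h4, ← h8])
  · exact absurd ⟨Or.inl h3, Or.inl h7⟩ hP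
  · exact absurd ⟨Or.inl h7, Or.inl h3⟩ hP
  · have e : (Q.1 : ℕ) = R.1 := by
      rw [← upNbr_upNbr Q.1.2, ← h1, h5, upNbr_upNbr R.1.2]
    exact RectPoint.ext e (by rw [← h4, ← h8]) (by rw [h2, h6, e])

/-- Away from the corners, points of the rectangles are identified by at most one gluing step. -/
theorem mk_eq_mk_of_not_isCorner {n : ℕ} {P Q : RectPoint n} (hP : ¬ IsCorner P)
    (h : (Quot.mk _ P : Staircase n) = Quot.mk _ Q) : Q = P ∨ Glue n P Q ∨ Glue n Q P := by
  have key : ∀ Q R, Glue n Q R →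
      ((Q = P ∨ Glue n P Q ∨ Glue n Q P) ↔ (R = P ∨ Glue n P R ∨ Glue n R P)) := by
    clear h
    intro Q R h
    constructor
    · rintro (rfl | h' | h')
      · exact Or.inr (Or.inl h)
      · exact absurd h (h'.not_glue (fun hQ => hP (h'.isCorner_iff.2 hQ)))
      · exact Or.inl (h.target_unique (fun hQ => hP (h'.isCorner_iff.1 hQ)) h')
    · rintro (rfl | h' | h')
      · exact Or.inr (Or.inr h)
      · exact Or.inl (h.source_unique (fun hQ => hP (h'.isCorner_iff.2 hQ)) h')
      · exact absurd h' (h.not_glue (fun hQ => hP (h'.isCorner_iff.1 hQ)))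
  have : (P = P ∨ Glue n P P ∨ Glue n P P) = (Q = P ∨ Glue n P Q ∨ Glue n Q P) :=
    congrArg (Quot.lift (r := Glue n) (fun Q => Q = P ∨ Glue n P Q ∨ Glue n Q P)
      fun Q R h => propext (key Q R h)) h
  exact this.mp (Or.inl rfl)

theorem finite_fibre {n : ℕ} {x : Staircase n} (hx : x ∉ singularities n) :
    {P : RectPoint n | Quot.mk _ P = x}.Finite := by
  induction x using Quot.ind with
  | mk P =>
  rw [mk_mem_singularities] at hx
  have h1 : {Q | Glue n P Q}.Finite :=
    Set.Subsingleton.finite fun Q hQ R hR => Glue.target_unique hx hQ hR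
  have h2 : {Q | Glue n Q P}.Finite :=
    Set.Subsingleton.finite fun Q hQ R hR => Glue.source_unique hx hQ hR
  refine ((Set.finite_singleton P).union (h1.union h2)).subset fun Q hQ => ?_
  exact mk_eq_mk_of_not_isCorner hx hQ.symm

/-! ### A criterion for membership in the Veech group -/

/-- `f` maps singularities to singularities, and small translations at nonsingular points to
translations by the image under `A`. This is one half of being affine with derivative `A`. -/
def MapsDisplaced {n : ℕ} (f : Staircase n → Staircase n) (A : SL(2, ℝ)) : Prop :=
  (∀ x ∈ singularities n, f x ∈ singularities n) ∧
  ∀ x, x ∉ singularities n → ∀ᶠ u in 𝓝 (0 : Fin 2 → ℝ), ∀ y,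
    Displaced x u y → Displaced (f x) (A • u) (f y)

theorem mem_veechGroup_of_mapsDisplaced {n : ℕ} {f g : Staircase n → Staircase n} {A : SL(2, ℝ)}
    (hf : Continuous f) (hg : Continuous g) (hgf : Function.LeftInverse g f)
    (hfg : Function.RightInverse g f) (hA : MapsDisplaced f A) (hA' : MapsDisplaced g A⁻¹) :
    A ∈ veechGroup n := by
  have hs : ∀ x, f x ∈ singularities n ↔ x ∈ singularities n :=
    fun x => ⟨fun h => by simpa [hgf x] using hA'.1 _ h, hA.1 x⟩
  refine ⟨⟨⟨f, g, hgf, hfg⟩, hf, hg⟩, hs, fun x hx => ?_⟩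
  obtain ⟨ε₁, h₁, H₁⟩ := Metric.eventually_nhds_iff.1 (hA.2 x hx)
  obtain ⟨ε₂, h₂, H₂⟩ := Metric.eventually_nhds_iff.1 (hA'.2 (f x) (mt (hs x).1 hx))
  obtain ⟨δ, hδ, H⟩ := exists_smul_small A h₂
  refine ⟨min ε₁ δ, lt_min h₁ hδ, fun u hu y => ⟨fun h => ?_, fun h => ?_⟩⟩
  · exact H₁ (by simpa using hu.trans_le (min_le_left _ _)) y h
  · have := H₂ (y := A • u) (by simpa using H u (hu.trans_le (min_le_right _ _))) (f y) h
    simpa [hgf x, hgf y] using this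

/-! ### The quarter turn of the staircase -/

/-- The quarter turn maps `R_i` to `R_{2n-i}`. -/
def turnPoint {n : ℕ} (P : RectPoint n) : RectPoint n :=
  ⟨⟨2 * n - P.1, by have := P.1.2; simp only [Set.mem_Icc] at *; omega⟩,
    ⟨![height n P.1 - P.2.1 1, P.2.1 0], by
      obtain ⟨h0, h1, h2, h3⟩ := P.2.2
      refine ⟨?_, ?_, ?_, ?_⟩ <;> simp [width_reflect P.1.2, height_reflect P.1.2] <;> linarith⟩⟩

theorem continuous_turnPoint (n : ℕ) : Continuous (turnPoint (n := n)) := by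
  refine continuous_sigma fun i => ?_
  let j : Set.Icc 1 (2 * n - 1) := ⟨2 * n - i, by have := i.2; simp only [Set.mem_Icc] at *; omega⟩
  have hc (k : Fin 2) : Continuous fun p : rect n (i : ℕ) => p.1 k :=
    (continuous_apply k).comp continuous_subtype_val
  have h : Continuous (Y := rect n (j : ℕ))
      fun p : rect n (i : ℕ) => (turnPoint ⟨i, p⟩).2 := by
    refine continuous_induced_rng.2 (continuous_pi fun k => ?_)
    fin_cases k
    · have h0 : Continuous fun p : rect n (i : ℕ) => height n i - p.1 1 :=
        continuous_const.sub (hc 1)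
      exact h0
    · exact hc 0
  exact (continuous_sigmaMk (σ := fun i : Set.Icc 1 (2 * n - 1) => rect n (i : ℕ)) (i := j)).comp h

theorem Glue.turnPoint {n : ℕ} {P Q : RectPoint n} (h : Glue n P Q) :
    Glue n (turnPoint P) (turnPoint Q) ∨ Glue n (turnPoint Q) (turnPoint P) := by
  rcases h with ⟨h1, h2, h3, h4⟩ | ⟨h1, h2, h3, h4⟩
  · left; right
    refine ⟨?_, ?_, ?_, ?_⟩
    · simp [DoublePolygon.turnPoint, upNbr_reflect P.1.2, h1]
    · simp [DoublePolygon.turnPoint, height_reflect P.1.2, h2]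
    · simp [DoublePolygon.turnPoint, h3]
    · simp [DoublePolygon.turnPoint, h1, h4, height_rightNbr P.1.2]
  · right; left
    refine ⟨?_, ?_, ?_, ?_⟩
    · simp only [DoublePolygon.turnPoint]
      rw [rightNbr_reflect Q.1.2, h1, upNbr_upNbr P.1.2]
    · simp [DoublePolygon.turnPoint, width_reflect Q.1.2, h3]
    · simp [DoublePolygon.turnPoint, h2]
    · simp [DoublePolygon.turnPoint, h4]

/-- The quarter turn of the staircase. -/
def turn (n : ℕ) : Staircase n → Staircase n :=
  Quot.lift (fun P => Quot.mk _ (turnPoint P)) fun _ _ h =>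
    h.turnPoint.elim Quot.sound fun h' => (Quot.sound h').symm

theorem continuous_turn (n : ℕ) : Continuous (turn n) :=
  continuous_quot_lift _ (continuous_quot_mk.comp (continuous_turnPoint n))

theorem turn_iterate_four {n : ℕ} (x : Staircase n) : turn n (turn n (turn n (turn n x))) = x := by
  induction x using Quot.ind with
  | mk P =>
  refine congrArg (Quot.mk _) (RectPoint.ext ?_ ?_ ?_)
  · have := P.1.2
    simp only [Set.mem_Icc] at this
    simp only [turnPoint]
    omega
  · have h' : 2 * n - (P.1 : ℕ) ∈ Set.Icc 1 (2 * n - 1) := (turnPoint P).1.2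
    have h'' : 2 * n - (2 * n - (P.1 : ℕ)) = P.1 := by
      have := P.1.2
      simp only [Set.mem_Icc] at this
      omega
    simp [turnPoint, h'', height_reflect P.1.2]
  · have h'' : 2 * n - (2 * n - (P.1 : ℕ)) = P.1 := by
      have := P.1.2
      simp only [Set.mem_Icc] at this
      omega
    simp [turnPoint, h'', height_reflect P.1.2]

theorem turn_mem_singularities {n : ℕ} {x : Staircase n} (hx : x ∈ singularities n) :
    turn n x ∈ singularities n := by
  induction x using Quot.ind with
  | mk P =>
  rw [mk_mem_singularities] at hx
  refine mk_mem_singularities.2 ?_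
  obtain ⟨h, h'⟩ := hx
  constructor
  · simp only [turnPoint, width_reflect P.1.2]
    rcases h' with h' | h' <;> simp [h']
  · simp only [turnPoint, height_reflect P.1.2]
    rcases h with h | h <;> simp [h]

theorem Displaced.turn {n : ℕ} {x y : Staircase n} {u : Fin 2 → ℝ} (h : Displaced x u y) :
    Displaced (turn n x) (quarterTurn • u) (turn n y) := by
  obtain ⟨i, p, q, h, rfl, rfl⟩ := h
  refine ⟨(turnPoint ⟨i, p⟩).1, (turnPoint ⟨i, p⟩).2, (turnPoint ⟨i, q⟩).2, ?_, rfl, rfl⟩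
  rw [sl_smul_eq]
  ext j
  fin_cases j
  · simp [turnPoint, quarterTurn, h]
    ring
  · simp [turnPoint, quarterTurn, h]

theorem quarterTurn_mem_veechGroup (n : ℕ) : quarterTurn ∈ veechGroup n := by
  have hinv : ∀ u : Fin 2 → ℝ, quarterTurn • quarterTurn • quarterTurn • u = quarterTurn⁻¹ • u := by
    intro u
    rw [eq_inv_smul_iff]
    simp only [sl_smul_eq]
    ext j
    fin_cases j <;> simp [quarterTurn]
  refine mem_veechGroup_of_mapsDisplaced (f := turn n) (g := fun x => turn n (turn n (turn n x)))
    (continuous_turn n) ?_ turn_iterate_four turn_iterate_four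
    ⟨fun x hx => turn_mem_singularities hx, fun x _ => .of_forall fun u y h => h.turn⟩
    ⟨fun x hx => turn_mem_singularities (turn_mem_singularities (turn_mem_singularities hx)),
      fun x _ => .of_forall fun u y h => ?_⟩
  · have := continuous_turn n
    fun_prop
  · rw [← hinv]
    exact h.turn.turn.turn

/-! ### Developing a horizontal cylinder -/

/-- The point of the staircase with coordinates `(x, y)` in `R_i`; coordinates outside the
rectangle are clamped. -/
def point {n : ℕ} (i : Set.Icc 1 (2 * n - 1)) (x y : ℝ) : Staircase n :=
  Quot.mk _ ⟨i, ⟨![max 0 (min x (width n i)), max 0 (min y (height n i))], by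
    have hw := (width_pos i.2).le
    have hh := (height_pos i.2).le
    refine ⟨?_, ?_, ?_, ?_⟩ <;> simp [hw, hh]⟩⟩

theorem point_eq_mk {n : ℕ} (P : RectPoint n) : point P.1 (P.2.1 0) (P.2.1 1) = Quot.mk _ P := by
  obtain ⟨h0, h1, h2, h3⟩ := P.2.2
  exact congrArg (Quot.mk _) (RectPoint.ext rfl (by simp [h0, h1]) (by simp [h2, h3]))

theorem continuous_point {n : ℕ} (i : Set.Icc 1 (2 * n - 1)) :
    Continuous fun p : ℝ × ℝ => point i p.1 p.2 := by
  refine continuous_quot_mk.comp (continuous_sigmaMk.comp (continuous_induced_rng.2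
    (continuous_pi fun k => ?_)))
  fin_cases k
  · have : Continuous fun p : ℝ × ℝ => max 0 (min p.1 (width n i)) := by fun_prop
    exact this
  · have : Continuous fun p : ℝ × ℝ => max 0 (min p.2 (height n i)) := by fun_prop
    exact this

/-- The rectangle to the right of `R_i`, which is also the one to its left. -/
def nbr {n : ℕ} (i : Set.Icc 1 (2 * n - 1)) : Set.Icc 1 (2 * n - 1) :=
  ⟨rightNbr i, rightNbr_mem i.2⟩

theorem nbr_nbr {n : ℕ} (i : Set.Icc 1 (2 * n - 1)) : nbr (nbr i) = i :=
  Subtype.ext (rightNbr_rightNbr i.2)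

theorem point_width {n : ℕ} (i : Set.Icc 1 (2 * n - 1)) (y : ℝ) :
    point i (width n i) y = point (nbr i) 0 y := by
  have hw := (width_pos i.2).le
  refine Quot.sound (Or.inl ⟨rfl, ?_, ?_, ?_⟩)
  · simp [hw]
  · simp [(width_pos (nbr i).2).le]
  · simp [nbr, height_rightNbr i.2]

theorem point_height {n : ℕ} (i : Set.Icc 1 (2 * n - 1)) (x : ℝ) :
    point i x (height n i) = point ⟨upNbr n i, upNbr_mem i.2⟩ x 0 := by
  have hh := (height_pos i.2).le
  refine Quot.sound (Or.inr ⟨rfl, ?_, ?_, ?_⟩)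
  · simp [hh]
  · simp [(height_pos (upNbr_mem i.2)).le]
  · simp [width_upNbr i.2]

theorem perimeter_pos {n : ℕ} (i : Set.Icc 1 (2 * n - 1)) : 0 < width n i + width n (nbr i) :=
  add_pos (width_pos i.2) (width_pos (nbr i).2)

/-- The developing map of the horizontal cylinder through `R_i`: the point that is reached from
the left side of `R_i`, at height `y`, after moving to the right by `x`. The cylinder consists of
`R_i` and `nbr i` (for `i = 1`, where `nbr i = i`, it is covered twice by one period). -/
def develop {n : ℕ} (i : Set.Icc 1 (2 * n - 1)) (x y : ℝ) : Staircase n :=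
  if toIcoMod (perimeter_pos i) 0 x ≤ width n i then point i (toIcoMod (perimeter_pos i) 0 x) y
  else point (nbr i) (toIcoMod (perimeter_pos i) 0 x - width n i) y

theorem develop_of_lt {n : ℕ} (i : Set.Icc 1 (2 * n - 1)) {x : ℝ} (y : ℝ) (h0 : 0 ≤ x)
    (h : x < width n i + width n (nbr i)) :
    develop i x y = if x ≤ width n i then point i x y else point (nbr i) (x - width n i) y := by
  rw [develop, (toIcoMod_eq_self (perimeter_pos i)).2 ⟨h0, by simpa using h⟩]

theorem develop_of_mem {n : ℕ} (i : Set.Icc 1 (2 * n - 1)) {x : ℝ} (y : ℝ) (h0 : 0 ≤ x)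
    (h : x ≤ width n i) : develop i x y = point i x y := by
  rw [develop_of_lt i y h0 (by linarith [width_pos (nbr i).2]), if_pos h]

theorem develop_add_perimeter_zsmul {n : ℕ} (i : Set.Icc 1 (2 * n - 1)) (x y : ℝ) (m : ℤ) :
    develop i (x + m • (width n i + width n (nbr i))) y = develop i x y := by
  rw [develop, develop, toIcoMod_add_zsmul]

theorem develop_add_perimeter {n : ℕ} (i : Set.Icc 1 (2 * n - 1)) (x y : ℝ) :
    develop i (x + (width n i + width n (nbr i))) y = develop i x y := by
  simpa using develop_add_perimeter_zsmul i x y 1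

theorem develop_add_width {n : ℕ} (i : Set.Icc 1 (2 * n - 1)) (x y : ℝ) :
    develop i (x + width n i) y = develop (nbr i) x y := by
  have hw := width_pos i.2
  have hw' := width_pos (nbr i).2
  -- it suffices to treat one period
  wlog hx : 0 ≤ x ∧ x < width n i + width n (nbr i) generalizing x
  · have hp := perimeter_pos i
    have h1 := toIcoMod_add_toIcoDiv_zsmul hp 0 x
    have h2 := toIcoMod_mem_Ico hp 0 x
    rw [zero_add] at h2
    have := this _ h2
    rw [← develop_add_perimeter_zsmul i _ y (toIcoDiv hp 0 x), add_right_comm, h1] at this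
    rw [this, ← develop_add_perimeter_zsmul (nbr i) _ y (toIcoDiv hp 0 x), nbr_nbr,
      add_comm (width n (nbr i)), h1]
  obtain ⟨h0, h1⟩ := hx
  rcases lt_trichotomy x (width n (nbr i)) with h | h | h
  · rw [develop_of_mem (nbr i) y h0 h.le, develop_of_lt i y (by linarith) (by linarith)]
    split_ifs with hle
    · obtain rfl : x = 0 := by linarith
      rw [zero_add, point_width]
    · rw [add_sub_cancel_right]
  · rw [h, develop_of_mem (nbr i) y hw'.le le_rfl, point_width, nbr_nbr,
      ← develop_of_mem i y le_rfl hw.le, ← develop_add_perimeter i 0]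
    congr 1
    ring
  · rw [develop_of_lt (nbr i) y h0 (by rw [nbr_nbr]; linarith), if_neg (by linarith), nbr_nbr,
      ← develop_of_mem i y (by linarith) (by linarith), ← develop_add_perimeter i (x - _)]
    congr 1
    ring

/-- At every point of a cylinder there is a rectangle that contains a segment to the right. -/
theorem exists_develop_eq_right {n : ℕ} (i : Set.Icc 1 (2 * n - 1)) (x : ℝ) :
    ∃ (k : Set.Icc 1 (2 * n - 1)) (a : ℝ), 0 ≤ a ∧ a < width n k ∧ height n k = height n i ∧
      ∀ s y, develop i (x + s) y = develop k (a + s) y := by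
  have hp := perimeter_pos i
  have h1 := toIcoMod_add_toIcoDiv_zsmul hp 0 x
  obtain ⟨h2, h3⟩ := toIcoMod_mem_Ico hp 0 x
  rw [zero_add] at h3
  have h4 (s y : ℝ) : develop i (x + s) y = develop i (toIcoMod hp 0 x + s) y := by
    rw [← develop_add_perimeter_zsmul i (toIcoMod hp 0 x + s) y (toIcoDiv hp 0 x),
      add_right_comm, h1]
  rcases lt_or_ge (toIcoMod hp 0 x) (width n i) with h | h
  · exact ⟨i, _, h2, h, rfl, h4⟩
  · refine ⟨nbr i, toIcoMod hp 0 x - width n i, by linarith, by linarith, height_rightNbr i.2,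
      fun s y => ?_⟩
    rw [h4, ← develop_add_width]
    congr 1
    ring

/-- At every point of a cylinder there is a rectangle that contains a segment to the left. -/
theorem exists_develop_eq_left {n : ℕ} (i : Set.Icc 1 (2 * n - 1)) (x : ℝ) :
    ∃ (k : Set.Icc 1 (2 * n - 1)) (a : ℝ), 0 < a ∧ a ≤ width n k ∧ height n k = height n i ∧
      ∀ s y, develop i (x + s) y = develop k (a + s) y := by
  obtain ⟨k, a, h0, h1, h2, h3⟩ := exists_develop_eq_right i x
  rcases h0.eq_or_lt with rfl | h0
  · refine ⟨nbr k, width n (nbr k), width_pos (nbr k).2, le_rfl, (height_rightNbr k.2).trans h2,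
      fun s y => ?_⟩
    rw [h3, zero_add, add_comm, develop_add_width, nbr_nbr]
  · exact ⟨k, a, h0, h1.le, h2, h3⟩

theorem continuous_develop {n : ℕ} (i : Set.Icc 1 (2 * n - 1)) :
    Continuous fun p : ℝ × ℝ => develop i p.1 p.2 := by
  have hpt (k : Set.Icc 1 (2 * n - 1)) (c : ℝ) :
      Continuous fun p : ℝ × ℝ => point k (c + p.1) p.2 :=
    (continuous_point k).comp (by fun_prop : Continuous fun p : ℝ × ℝ => (c + p.1, p.2))
  refine continuous_iff_continuousAt.2 fun p => ?_
  -- glue the continuity on the two half-planes bounded by the vertical line through `p`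
  have hu : {q : ℝ × ℝ | p.1 ≤ q.1} ∪ {q | q.1 ≤ p.1} = Set.univ :=
    Set.eq_univ_of_forall fun q => le_total p.1 q.1
  rw [← continuousWithinAt_univ, ← hu]
  have hcont : Continuous fun q : ℝ × ℝ => q.1 := continuous_fst
  refine ContinuousWithinAt.union ?_ ?_
  · obtain ⟨k, a, h0, h1, -, h3⟩ := exists_develop_eq_right i p.1
    have hev : ∀ q : ℝ × ℝ, p.1 ≤ q.1 → a - p.1 + q.1 < width n k →
        develop i q.1 q.2 = point k (a - p.1 + q.1) q.2 := by
      intro q hq hq'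
      have := h3 (q.1 - p.1) q.2
      rw [add_sub_cancel, develop_of_mem k _ (by linarith) (by linarith)] at this
      rw [this]
      congr 1
      ring
    refine (hpt k (a - p.1)).continuousWithinAt.congr_of_eventuallyEq ?_
      (hev p le_rfl (by linarith))
    have : ∀ᶠ q in 𝓝 p, a - p.1 + q.1 < width n k :=
      (continuous_const.add hcont).continuousAt.eventually_lt continuousAt_const (by simpa using h1)
    filter_upwards [self_mem_nhdsWithin, nhdsWithin_le_nhds this] with q hq hq' using hev q hq hq'
  · obtain ⟨k, a, h0, h1, -, h3⟩ := exists_develop_eq_left i p.1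
    have hev : ∀ q : ℝ × ℝ, q.1 ≤ p.1 → 0 < a - p.1 + q.1 →
        develop i q.1 q.2 = point k (a - p.1 + q.1) q.2 := by
      intro q hq hq'
      have := h3 (q.1 - p.1) q.2
      rw [add_sub_cancel, develop_of_mem k _ (by linarith) (by linarith)] at this
      rw [this]
      congr 1
      ring
    refine (hpt k (a - p.1)).continuousWithinAt.congr_of_eventuallyEq ?_
      (hev p le_rfl (by linarith))
    have : ∀ᶠ q in 𝓝 p, 0 < a - p.1 + q.1 :=
      continuousAt_const.eventually_lt (continuous_const.add hcont).continuousAt (by simpa using h0)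
    filter_upwards [self_mem_nhdsWithin, nhdsWithin_le_nhds this] with q hq hq' using hev q hq hq'

theorem develop_add_modulus {n : ℕ} (i : Set.Icc 1 (2 * n - 1)) (x y : ℝ) :
    develop i (x + modulus n * height n i) y = develop i x y := by
  by_cases h : (i : ℕ) = 1
  · have hn : 0 < n := by have := i.2; simp only [Set.mem_Icc] at this; omega
    have h1 : nbr i = i := Subtype.ext (by simp [nbr, rightNbr, h])
    have h2 := develop_add_width i x y
    rw [h, ← modulus_mul_height_one hn, ← h, h1] at h2
    exact h2
  · rw [modulus_mul_height i.2 h]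
    exact develop_add_perimeter i x y

/-! ### The horizontal multitwist -/

/-- `c` is such that a horizontal shear with coefficient `c` moves the top of each horizontal
cylinder by a multiple of its circumference. -/
def IsTwistCoefficient (n : ℕ) (c : ℝ) : Prop :=
  ∀ (i : Set.Icc 1 (2 * n - 1)) (x y : ℝ), develop i (x + c * height n i) y = develop i x y

theorem isTwistCoefficient_modulus (n : ℕ) : IsTwistCoefficient n (modulus n) :=
  develop_add_modulus

theorem IsTwistCoefficient.neg {n : ℕ} {c : ℝ} (h : IsTwistCoefficient n c) :
    IsTwistCoefficient n (-c) := by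
  intro i x y
  rw [← h i (x + -c * height n i) y]
  congr 1
  ring

theorem develop_self {n : ℕ} (P : RectPoint n) :
    develop P.1 (P.2.1 0) (P.2.1 1) = Quot.mk _ P := by
  rw [develop_of_mem _ _ P.2.2.1 P.2.2.2.1, point_eq_mk]

/-- The multitwist: it shears each horizontal cylinder and fixes its boundary. -/
def twist {n : ℕ} {c : ℝ} (hc : IsTwistCoefficient n c) : Staircase n → Staircase n :=
  Quot.lift (fun P => develop P.1 (P.2.1 0 + c * P.2.1 1) (P.2.1 1)) <| by
    rintro P Q (⟨h1, h2, h3, h4⟩ | ⟨h1, h2, h3, h4⟩)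
    · have h : Q.1 = nbr P.1 := Subtype.ext h1
      simp only [h, h2, h3, h4]
      rw [add_comm, develop_add_width, zero_add]
    · have h : Q.1 = ⟨upNbr n P.1, upNbr_mem P.1.2⟩ := Subtype.ext h1
      have hw : width n Q.1 = width n P.1 := by rw [h1, width_upNbr P.1.2]
      obtain ⟨h5, h6, -, -⟩ := P.2.2
      simp only [h2, h3, h4]
      rw [hc, mul_zero, add_zero, develop_of_mem _ _ h5 h6, develop_of_mem _ _ h5 (hw ▸ h6),
        point_height, h]

theorem twist_mk {n : ℕ} {c : ℝ} (hc : IsTwistCoefficient n c) (P : RectPoint n) :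
    twist hc (Quot.mk _ P) = develop P.1 (P.2.1 0 + c * P.2.1 1) (P.2.1 1) := rfl

theorem twist_develop {n : ℕ} {c : ℝ} (hc : IsTwistCoefficient n c) (i : Set.Icc 1 (2 * n - 1))
    (x : ℝ) {y : ℝ} (h0 : 0 ≤ y) (h1 : y ≤ height n i) :
    twist hc (develop i x y) = develop i (x + c * y) y := by
  obtain ⟨k, a, h2, h3, h4, h5⟩ := exists_develop_eq_right i x
  have h6 := h5 0 y
  rw [add_zero, add_zero] at h6
  rw [h5, h6]
  have := twist_mk hc ⟨k, ⟨![a, y], ⟨h2, h3.le, h0, h4 ▸ h1⟩⟩⟩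
  rw [← develop_self] at this
  exact this

theorem twist_twist {n : ℕ} {c d : ℝ} (hc : IsTwistCoefficient n c) (hd : IsTwistCoefficient n d)
    (h : c + d = 0) (x : Staircase n) : twist hd (twist hc x) = x := by
  induction x using Quot.ind with
  | mk P =>
  rw [twist_mk, twist_develop hd _ _ P.2.2.2.2.1 P.2.2.2.2.2]
  have : P.2.1 0 + c * P.2.1 1 + d * P.2.1 1 = P.2.1 0 := by linear_combination P.2.1 1 * h
  rw [this, develop_self]

theorem continuous_twist {n : ℕ} {c : ℝ} (hc : IsTwistCoefficient n c) : Continuous (twist hc) := by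
  refine continuous_quot_lift _ (continuous_sigma fun i => ?_)
  have h (k : Fin 2) : Continuous fun p : rect n (i : ℕ) => p.1 k :=
    (continuous_apply k).comp continuous_subtype_val
  exact (continuous_develop i).comp
    (((h 0).add (continuous_const.mul (h 1))).prodMk (h 1))

theorem twist_of_mem_singularities {n : ℕ} {c : ℝ} (hc : IsTwistCoefficient n c) {x : Staircase n}
    (hx : x ∈ singularities n) : twist hc x = x := by
  obtain ⟨P, -, h, rfl⟩ := hx
  rw [twist_mk, ← develop_self]
  rcases h with h | h
  · rw [h, mul_zero, add_zero]
  · rw [h, hc]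

theorem mapsDisplaced_twist {n : ℕ} {c : ℝ} (hc : IsTwistCoefficient n c) :
    MapsDisplaced (twist hc) (shear c) := by
  refine ⟨fun x hx => by rwa [twist_of_mem_singularities hc hx], fun x hx => ?_⟩
  have key : ∀ P : RectPoint n, ∀ᶠ u in 𝓝 (0 : Fin 2 → ℝ), ∀ q : rect n (P.1 : ℕ),
      q.1 = P.2.1 + u → Displaced (twist hc (Quot.mk _ P)) (shear c • u)
        (twist hc (Quot.mk _ ⟨P.1, q⟩)) := by
    intro P
    obtain ⟨k, a, h0, h1, h2, h3⟩ := exists_develop_eq_right P.1 (P.2.1 0 + c * P.2.1 1)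
    obtain ⟨l, b, k0, k1, k2, k3⟩ := exists_develop_eq_left P.1 (P.2.1 0 + c * P.2.1 1)
    have hcont : Continuous fun u : Fin 2 → ℝ => u 0 + c * u 1 := by fun_prop
    have e1 : ∀ᶠ u : Fin 2 → ℝ in 𝓝 0, u 0 + c * u 1 < width n k - a :=
      hcont.continuousAt.eventually_lt continuousAt_const (by simpa using h1)
    have e2 : ∀ᶠ u : Fin 2 → ℝ in 𝓝 0, -b < u 0 + c * u 1 :=
      continuousAt_const.eventually_lt hcont.continuousAt (by simpa using k0)
    filter_upwards [e1, e2] with u hu1 hu2 q hq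
    obtain ⟨-, -, r2, r3⟩ := P.2.2
    obtain ⟨-, -, q2, q3⟩ := q.2
    -- whichever side the displacement points to, one rectangle contains both points
    have main : ∀ (k : Set.Icc 1 (2 * n - 1)) (a : ℝ), 0 ≤ a → a ≤ width n k →
        0 ≤ a + (u 0 + c * u 1) → a + (u 0 + c * u 1) ≤ width n k →
        height n k = height n P.1 →
        (∀ s y, develop P.1 (P.2.1 0 + c * P.2.1 1 + s) y = develop k (a + s) y) →
        Displaced (twist hc (Quot.mk _ P)) (shear c • u) (twist hc (Quot.mk _ ⟨P.1, q⟩)) := by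
      intro k a h0 h1 h0' h1' h2 h3
      refine ⟨k, ⟨![a, P.2.1 1], ⟨h0, h1, r2, h2 ▸ r3⟩⟩,
        ⟨![a + (u 0 + c * u 1), q.1 1], ⟨h0', h1', q2, h2 ▸ q3⟩⟩, ?_, ?_, ?_⟩
      · rw [sl_smul_eq]
        ext j
        fin_cases j <;> simp [shear, hq]
      · rw [twist_mk, ← add_zero (P.2.1 0 + c * P.2.1 1), h3, ← develop_self, add_zero]
        rfl
      · rw [twist_mk, ← develop_self]
        have : q.1 0 + c * q.1 1 = P.2.1 0 + c * P.2.1 1 + (u 0 + c * u 1) := by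
          rw [hq]
          simp only [Pi.add_apply]
          ring
        simp only [this, h3]
        rfl
    rcases le_total 0 (u 0 + c * u 1) with hu | hu
    · exact main k a h0 h1.le (by linarith) (by linarith) h2 h3
    · exact main l b k0.le k1 (by linarith) (by linarith) k2 k3
  filter_upwards [(eventually_all_finite (finite_fibre hx)).2 fun P _ => key P] with u hu y hy
  obtain ⟨i, p, q, hpq, rfl, rfl⟩ := hy
  exact hu ⟨i, p⟩ rfl q hpq

theorem shear_inv (c : ℝ) : (shear c)⁻¹ = shear (-c) := by
  apply Subtype.ext
  rw [Matrix.SpecialLinearGroup.coe_inv]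
  simp [shear, Matrix.adjugate_fin_two_of]

theorem shear_mem_veechGroup (n : ℕ) : shear (modulus n) ∈ veechGroup n := by
  have h := isTwistCoefficient_modulus n
  refine mem_veechGroup_of_mapsDisplaced (continuous_twist h) (continuous_twist h.neg)
    (twist_twist h h.neg (by ring)) (twist_twist h.neg h (by ring)) (mapsDisplaced_twist h) ?_
  rw [shear_inv]
  exact mapsDisplaced_twist h.neg

theorem M_mem_veechGroup {n : ℕ} (i : Fin (2 * n)) : M n i ∈ veechGroup n := by
  rw [M_eq]
  have h := quarterTurn_mem_veechGroup n
  exact mul_mem (pow_mem (mul_mem (shear_mem_veechGroup n) h) _) (inv_mem h)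

theorem wordProd_mem_veechGroup {n : ℕ} (w : List (Fin (2 * n))) :
    wordProd n w ∈ veechGroup n := by
  induction w with
  | nil => rw [wordProd_nil]; exact one_mem _
  | cons i w ih => rw [wordProd_cons]; exact mul_mem (M_mem_veechGroup i) ih

/-! ### The trace field is contained in the field of ratios of side lengths -/

/-- The field `ℚ(2 cos (π / (2n+1)))`. -/
def sideField (n : ℕ) : Subfield ℝ := Subfield.closure {modulus n}

theorem side_div_mem_sideField {n : ℕ} (hn : 0 < n) (i : ℕ) :
    side n i / side n 1 ∈ sideField n := by
  induction i using Nat.twoStepInduction with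
  | zero => rw [side_zero, zero_div]; exact zero_mem _
  | one => rw [div_self (side_one_pos hn).ne']; exact one_mem _
  | more i h0 h1 =>
    rw [side_add_two hn, sub_div, mul_div_assoc]
    exact sub_mem (mul_mem (Subfield.subset_closure rfl) h1) h0

/-- The vectors whose coordinates are `side n 1` times elements of `sideField n`. They contain
all translations by which the rectangles are glued. -/
def periodGroup (n : ℕ) : AddSubgroup (Fin 2 → ℝ) where
  carrier := {v | ∀ j, v j / side n 1 ∈ sideField n}
  zero_mem' j := by simp
  add_mem' hv hw j := by
    rw [Pi.add_apply, add_div]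
    exact add_mem (hv j) (hw j)
  neg_mem' hv j := by
    rw [Pi.neg_apply, neg_div]
    exact neg_mem (hv j)

theorem width_div_mem {n : ℕ} (hn : 0 < n) (i : ℕ) : width n i / side n 1 ∈ sideField n := by
  rw [width]
  split_ifs <;> exact side_div_mem_sideField hn _

theorem height_div_mem {n : ℕ} (hn : 0 < n) (i : ℕ) : height n i / side n 1 ∈ sideField n := by
  rw [height]
  split_ifs <;> exact side_div_mem_sideField hn _

/-- The position of a point of the staircase in the plane, which is well defined modulo
`periodGroup n`. -/
def position {n : ℕ} (hn : 0 < n) : Staircase n → (Fin 2 → ℝ) ⧸ periodGroup n :=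
  Quot.lift (fun P => QuotientAddGroup.mk P.2.1) <| by
    intro P Q h
    rw [eq_comm, QuotientAddGroup.eq]
    intro j
    rcases h with ⟨-, h2, h3, h4⟩ | ⟨-, h2, h3, h4⟩ <;> fin_cases j
    · simpa [h2, h3] using width_div_mem hn P.1
    · simp [h4]
    · simp [h4]
    · simpa [h2, h3] using height_div_mem hn P.1

theorem Displaced.position_eq {n : ℕ} (hn : 0 < n) {x y : Staircase n} {u : Fin 2 → ℝ}
    (h : Displaced x u y) : position hn y = position hn x + QuotientAddGroup.mk u := by
  obtain ⟨i, p, q, h, rfl, rfl⟩ := h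
  change QuotientAddGroup.mk q.1 = QuotientAddGroup.mk p.1 + QuotientAddGroup.mk u
  rw [h]
  rfl

/-- The derivative of an affine diffeomorphism maps the holonomy of a closed straight path through
nonsingular points to the holonomy of the image of the path, hence into `periodGroup n`. -/
theorem smul_mem_periodGroup {n : ℕ} (hn : 0 < n) {A : SL(2, ℝ)} (hA : A ∈ veechGroup n)
    (γ : unitInterval → Staircase n) (v : Fin 2 → ℝ) (hγ : ∀ t, γ t ∉ singularities n)
    (hv : ∀ s t : unitInterval, Displaced (γ s) (((t : ℝ) - s) • v) (γ t)) (h01 : γ 0 = γ 1) :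
    A • v ∈ periodGroup n := by
  obtain ⟨f, -, hf⟩ := hA
  let g : unitInterval → (Fin 2 → ℝ) ⧸ periodGroup n := fun t =>
    position hn (f (γ t)) - QuotientAddGroup.mk (A • ((t : ℝ) • v))
  have hg : IsLocallyConstant g := by
    rw [IsLocallyConstant.iff_eventually_eq]
    intro s
    obtain ⟨ε, hε, H⟩ := hf (γ s) (hγ s)
    have hc : Continuous fun t : unitInterval => ((t : ℝ) - s) • v := by fun_prop
    have : ∀ᶠ t : unitInterval in 𝓝 s, ‖((t : ℝ) - s) • v‖ < ε :=
      hc.norm.continuousAt.eventually_lt continuousAt_const (by simpa using hε)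
    filter_upwards [this] with t ht
    have h1 := ((H _ ht _).1 (hv s t)).position_eq hn
    have h2 : A • ((t : ℝ) • v) = A • ((s : ℝ) • v) + A • (((t : ℝ) - s) • v) := by
      rw [← smul_add, ← add_smul, add_sub_cancel]
    simp only [g]
    rw [h1, h2, QuotientAddGroup.mk_add]
    abel
  have h := hg.apply_eq_of_preconnectedSpace 0 1
  simp only [g, h01, sub_right_inj] at h
  rw [QuotientAddGroup.eq] at h
  simpa using h

/-- The core curve of the cylinder `R_1` gives the first column, that of the vertical cylinder
`R_{2n-1}` the second. -/
theorem apply_mem_sideField {n : ℕ} (hn : 0 < n) {A : SL(2, ℝ)} (hA : A ∈ veechGroup n)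
    (j k : Fin 2) : A.1 j k ∈ sideField n := by
  have i1 : 1 ∈ Set.Icc 1 (2 * n - 1) := ⟨le_rfl, by omega⟩
  have i2 : 2 * n - 1 ∈ Set.Icc 1 (2 * n - 1) := ⟨by omega, le_rfl⟩
  have h1 : A • ![width n 1, 0] ∈ periodGroup n := by
    have hw := width_pos i1
    have hh := height_pos i1
    let P (t : unitInterval) : RectPoint n := ⟨⟨1, i1⟩, ⟨![t * width n 1, height n 1 / 2], by
      refine ⟨mul_nonneg t.2.1 hw.le, mul_le_of_le_one_left hw.le t.2.2, ?_, ?_⟩ <;> simp <;>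
        linarith⟩⟩
    refine smul_mem_periodGroup hn hA (fun t => Quot.mk _ (P t)) _ (fun t => ?_)
      (fun s t => ?_) (Quot.sound (r := Glue n) (Or.inl ?_)).symm
    · rw [mk_mem_singularities]
      rintro ⟨-, h | h⟩ <;> simp [P] at h <;> linarith
    · refine ⟨⟨1, i1⟩, (P s).2, (P t).2, ?_, rfl, rfl⟩
      ext j
      fin_cases j <;> simp [P]
      ring
    · simp [P, rightNbr]
  have h2 : A • ![0, height n (2 * n - 1)] ∈ periodGroup n := by
    have hw := width_pos i2
    have hh := height_pos i2
    let P (t : unitInterval) : RectPoint n := ⟨⟨2 * n - 1, i2⟩,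
      ⟨![width n (2 * n - 1) / 2, t * height n (2 * n - 1)], by
      refine ⟨?_, ?_, mul_nonneg t.2.1 hh.le, mul_le_of_le_one_left hh.le t.2.2⟩ <;> simp <;>
        linarith⟩⟩
    refine smul_mem_periodGroup hn hA (fun t => Quot.mk _ (P t)) _ (fun t => ?_)
      (fun s t => ?_) (Quot.sound (r := Glue n) (Or.inr ?_)).symm
    · rw [mk_mem_singularities]
      rintro ⟨h | h, -⟩ <;> simp [P] at h <;> linarith
    · refine ⟨⟨2 * n - 1, i2⟩, (P s).2, (P t).2, ?_, rfl, rfl⟩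
      ext j
      fin_cases j <;> simp [P]
      ring
    · simp [P, upNbr]
  have hs := side_one_pos hn
  fin_cases k
  · have hw := width_pos i1
    have := h1 j
    rw [sl_smul_eq] at this
    have e : A.1 j 0 = (A.1 j 0 * width n 1 / side n 1) / (width n 1 / side n 1) := by field_simp
    change A.1 j 0 ∈ _
    rw [e]
    refine div_mem ?_ (width_div_mem hn 1)
    fin_cases j <;> simpa using this
  · have hw := height_pos i2
    have := h2 j
    rw [sl_smul_eq] at this
    have e : A.1 j 1 = (A.1 j 1 * height n (2 * n - 1) / side n 1) /
        (height n (2 * n - 1) / side n 1) := by field_simp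
    change A.1 j 1 ∈ _
    rw [e]
    refine div_mem ?_ (height_div_mem hn _)
    fin_cases j <;> simpa using this

theorem traceField_le_sideField {n : ℕ} (hn : 0 < n) : traceField n ≤ sideField n := by
  refine Subfield.closure_le.2 ?_
  rintro _ ⟨A, hA, rfl⟩
  rw [trace_eq]
  exact add_mem (apply_mem_sideField hn hA 0 0) (apply_mem_sideField hn hA 1 1)

/-! ### A Galois conjugation -/

/-- The numbers `2 cos (2 k π / (2n+1))`. -/
def twoCos (n k : ℕ) : ℝ := 2 * Real.cos (k * (2 * Real.pi / (2 * n + 1)))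

theorem twoCos_le_two (n k : ℕ) : twoCos n k ≤ 2 := by
  rw [twoCos]
  linarith [Real.cos_le_one (k * (2 * Real.pi / (2 * n + 1)))]

theorem four_mul_side_mul_side (n i : ℕ) :
    4 * (side n i * side n (i + 2)) = twoCos n 1 - twoCos n (i + 1) := by
  have h := Real.cos_sub_cos (1 * (2 * Real.pi / (2 * n + 1)))
    ((i + 1 : ℕ) * (2 * Real.pi / (2 * n + 1)))
  have e1 : (1 * (2 * Real.pi / (2 * n + 1)) + (i + 1 : ℕ) * (2 * Real.pi / (2 * n + 1))) / 2
      = (i + 2 : ℕ) * Real.pi / (2 * n + 1) := by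
    push_cast; field_simp; ring
  have e2 : (1 * (2 * Real.pi / (2 * n + 1)) - (i + 1 : ℕ) * (2 * Real.pi / (2 * n + 1))) / 2
      = -(i * Real.pi / (2 * n + 1)) := by
    push_cast; field_simp; ring
  rw [e1, e2, Real.sin_neg] at h
  rw [twoCos, twoCos, side, side, Nat.cast_one, ← mul_sub, h]
  ring

theorem four_mul_side_sq (n i : ℕ) : 4 * (side n i * side n i) = 2 - twoCos n i := by
  have e : (i : ℝ) * (2 * Real.pi / (2 * n + 1)) = 2 * (i * Real.pi / (2 * n + 1)) := by ring
  rw [twoCos, e, Real.cos_two_mul, side]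
  linear_combination 4 * Real.sin_sq_add_cos_sq (i * Real.pi / (2 * n + 1))

theorem modulus_eq {n : ℕ} (hn : 0 < n) : modulus n = -twoCos n n := by
  have h1 := side_one_pos hn
  have e : (n : ℝ) * (2 * Real.pi / (2 * n + 1)) = Real.pi - (1 : ℕ) * Real.pi / (2 * n + 1) := by
    push_cast; field_simp; ring
  rw [modulus, div_eq_iff h1.ne', twoCos, e, Real.cos_pi_sub, side, side, Nat.cast_two,
    show (2 : ℝ) * Real.pi / (2 * n + 1) = 2 * ((1 : ℕ) * Real.pi / (2 * n + 1)) by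
      push_cast; ring, Real.sin_two_mul]
  ring

/-- Among the numbers `twoCos n m`, `twoCos n n` is the smallest. -/
theorem twoCos_self_lt {n m : ℕ} (h1 : 2 ≤ m) (h2 : m + 1 ≤ 2 * n) :
    twoCos n (n * 1) < twoCos n (n * m) := by
  have hpi := Real.pi_pos
  have hN : (0 : ℝ) < 2 * n + 1 := by positivity
  have hm1 : (2 : ℝ) ≤ m := by exact_mod_cast h1
  have hm2 : (m : ℝ) + 1 ≤ 2 * n := by exact_mod_cast h2
  have e (k : ℕ) : ((n * k : ℕ) : ℝ) * (2 * Real.pi / (2 * n + 1)) =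
      (k : ℕ) * Real.pi - k * (Real.pi / (2 * n + 1)) := by
    push_cast; field_simp; ring
  set δ := Real.pi / (2 * n + 1) with hδ
  have hδ0 : 0 < δ := by positivity
  have hδN : (2 * n + 1) * δ = Real.pi := by rw [hδ]; field_simp
  have c1 : Real.cos (m * δ) < Real.cos δ :=
    Real.cos_lt_cos_of_nonneg_of_le_pi hδ0.le (by nlinarith) (by nlinarith)
  have c2 : Real.cos (Real.pi - δ) < Real.cos (m * δ) :=
    Real.cos_lt_cos_of_nonneg_of_le_pi (by positivity) (by linarith) (by nlinarith)
  rw [Real.cos_pi_sub] at c2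
  rw [twoCos, twoCos, e, e, Real.cos_nat_mul_pi_sub, Real.cos_nat_mul_pi_sub]
  rcases neg_one_pow_eq_or ℝ m with h | h <;> rw [h] <;> simp <;> linarith

open IntermediateField Polynomial in
/-- The squares in `sideField n` do not contain `s_i / s_{i+2}`, since this number has a negative
Galois conjugate: the one under `ζ ↦ ζ ^ n`, for `ζ` a primitive `(2n+1)`-th root of unity. -/
theorem sq_mul_side_ne {n i : ℕ} (h1 : 1 ≤ i) (h2 : i + 2 ≤ 2 * n) {u : ℝ}
    (hu : u ∈ sideField n) : u ^ 2 * side n (i + 2) ≠ side n i := by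
  intro hsq
  have hn : 0 < n := by omega
  let ζ : ℂ := Complex.exp (2 * Real.pi * Complex.I / (2 * n + 1 : ℕ))
  have hζ : IsPrimitiveRoot ζ (2 * n + 1) := Complex.isPrimitiveRoot_exp _ (by omega)
  have hζn : IsPrimitiveRoot (ζ ^ n) (2 * n + 1) := hζ.pow_of_coprime n (by simp)
  have hint : IsIntegral ℚ ζ := (hζ.isIntegral (by omega)).tower_top
  have htc (k : ℕ) : ((twoCos n k : ℝ) : ℂ) = ζ ^ k + (ζ ^ k)⁻¹ := by
    have e : ζ ^ k = Complex.exp (((k * (2 * Real.pi / (2 * n + 1)) : ℝ) : ℂ) * Complex.I) := by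
      rw [← Complex.exp_nat_mul]
      congr 1
      push_cast
      ring
    rw [e, ← Complex.exp_neg, twoCos, Complex.ofReal_mul, Complex.ofReal_cos, Complex.ofReal_ofNat,
      Complex.two_cos, neg_mul]
  let pb := adjoin.powerBasis hint
  have hmin : minpoly ℚ pb.gen = minpoly ℚ ζ := by
    rw [adjoin.powerBasis_gen]
    exact minpoly_gen ℚ ζ
  have hroot : aeval (ζ ^ n) (minpoly ℚ pb.gen) = 0 := by
    rw [hmin, ← cyclotomic_eq_minpoly_rat hζ (by omega), ← eval_map_algebraMap, map_cyclotomic]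
    exact hζn.isRoot_cyclotomic (by omega)
  let φ : ℚ⟮ζ⟯ →ₐ[ℚ] ℂ := pb.lift (ζ ^ n) hroot
  let g : ℚ⟮ζ⟯ := pb.gen
  have hgζ : (g : ℂ) = ζ := congrArg Subtype.val (adjoin.powerBasis_gen hint)
  have hφg : φ g = ζ ^ n := pb.lift_gen (ζ ^ n) hroot
  have hg (k : ℕ) : ((g ^ k + (g ^ k)⁻¹ : ℚ⟮ζ⟯) : ℂ) = twoCos n k := by
    rw [htc]; simp [hgζ]
  have hφ (k : ℕ) : φ (g ^ k + (g ^ k)⁻¹) = twoCos n (n * k) := by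
    rw [map_add, map_inv₀, map_pow, hφg, htc, pow_mul]
  -- the real numbers in `ℚ(ζ)` that `φ` maps to real numbers
  let L : Subfield ℝ := ((Complex.ofRealHom.fieldRange.comap (φ : ℚ⟮ζ⟯ →+* ℂ)).map
    (algebraMap ℚ⟮ζ⟯ ℂ)).comap Complex.ofRealHom
  have hL : sideField n ≤ L := by
    refine Subfield.closure_le.2 (Set.singleton_subset_iff.2 ?_)
    refine ⟨-(g ^ n + (g ^ n)⁻¹), ⟨-twoCos n (n * n), ?_⟩, ?_⟩
    · simp only [RingHom.coe_coe, map_neg, hφ, Complex.ofRealHom_eq_coe]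
    · rw [map_neg, modulus_eq hn, map_neg]
      exact congrArg _ (hg n)
  obtain ⟨e, ⟨r, hr⟩, he⟩ := hL hu
  have hreal : u ^ 2 * (2 - twoCos n (i + 2)) = twoCos n 1 - twoCos n (i + 1) := by
    rw [← four_mul_side_mul_side, ← four_mul_side_sq, ← hsq]
    ring
  have hE : e ^ 2 * (2 - (g ^ (i + 2) + (g ^ (i + 2))⁻¹)) =
      (g ^ 1 + (g ^ 1)⁻¹) - (g ^ (i + 1) + (g ^ (i + 1))⁻¹) := by
    apply (algebraMap ℚ⟮ζ⟯ ℂ).injective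
    have hg' (k : ℕ) : algebraMap ℚ⟮ζ⟯ ℂ (g ^ k + (g ^ k)⁻¹) = twoCos n k := hg k
    rw [map_mul, map_pow, map_sub, map_sub, hg', hg', hg', he, map_ofNat]
    have := congrArg Complex.ofReal hreal
    push_cast at this
    exact this
  have hconj := congrArg φ hE
  have hr' : φ e = (r : ℂ) := hr.symm
  rw [map_mul, map_pow, map_sub, map_sub, hφ, hφ, hφ, hr', map_ofNat] at hconj
  have hconj' : r ^ 2 * (2 - twoCos n (n * (i + 2))) =
      twoCos n (n * 1) - twoCos n (n * (i + 1)) := by exact_mod_cast hconj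
  have hlt := twoCos_self_lt (n := n) (m := i + 1) (by omega) (by omega)
  have := mul_nonneg (sq_nonneg r) (sub_nonneg.2 (twoCos_le_two n (n * (i + 2))))
  linarith

/-- No fixed point of the gcd algorithm other than the horizontal direction has a slope in
`sideField n`. -/
theorem gcdStep_ofSlope_ne {n : ℕ} (hn : 0 < n) {u : ℝ} (hu0 : 0 < u) (hu : u ∈ sideField n) :
    gcdStep n (ofSlope u) ≠ ofSlope u := by
  intro h
  obtain ⟨i, v, hv, e⟩ := exists_eq_M_smul hn hu0.le
  have h' := gcdStep_M_smul i hv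
  rw [← e, h] at h'
  obtain rfl := ofSlope_injective h'
  have hq := quadratic_of_smul_ofSlope_eq e.symm
  simp only [coe_M] at hq
  simp at hq
  have h1 := side_one_pos hn
  field_simp at hq
  have hq' : u ^ 2 * side n (i + 2) = side n i := by linear_combination -hq
  refine sq_mul_side_ne (n := n) (i := i) ?_ ?_ hu hq'
  · by_contra hi
    obtain hi : (i : ℕ) = 0 := by omega
    have := side_pos (n := n) (i := i + 2) (by omega) (by omega)
    have h0 : side n i = 0 := by rw [hi, side_zero]
    rw [h0] at hq'
    have : 0 < u ^ 2 * side n (i + 2) := by positivity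
    linarith
  · by_contra hi
    have h0 : side n (i + 2) = 0 := by
      rw [show (i : ℕ) + 2 = 2 * n + 1 by omega, side_last]
    have := side_pos (n := n) (i := i) (by omega) (by omega)
    rw [h0] at hq'
    linarith

theorem IsEventuallyPeriodic.endsWithPeriodGeTwo {n : ℕ} (hn : 0 < n) {t : ℝ} (ht : 0 ≤ t)
    (htK : t ∈ sideField n) (h : IsEventuallyPeriodic n (ofSlope t)) :
    EndsWithPeriodGeTwo n (ofSlope t) := by
  obtain ⟨k, l, hkl, h, h'⟩ := h
  obtain ⟨I, u, -, hu, e1, e2⟩ := exists_eq_wordProd_smul_iterate hn k ht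
  have hu0 : u ≠ 0 := by
    rintro rfl
    exact h' e1
  refine ⟨k, ?_⟩
  have hper : Function.IsPeriodicPt (gcdStep n) (l - k) ((gcdStep n)^[k] (ofSlope t)) := by
    rw [Function.IsPeriodicPt, Function.IsFixedPt, ← Function.iterate_add_apply,
      Nat.sub_add_cancel hkl.le, h]
  have hpos := hper.minimalPeriod_pos (by omega)
  have hne : Function.minimalPeriod (gcdStep n) ((gcdStep n)^[k] (ofSlope t)) ≠ 1 := by
    rw [Ne, Function.minimalPeriod_eq_one_iff_isFixedPt, e1]
    refine gcdStep_ofSlope_ne hn (lt_of_le_of_ne hu hu0.symm) ?_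
    have hq := quadratic_of_smul_ofSlope_eq e2.symm
    have hA := apply_mem_sideField hn (wordProd_mem_veechGroup I)
    have hd := (wordProd n I).det_coe
    rw [Matrix.det_fin_two] at hd
    generalize wordProd n I = A at *
    have hne : A.1 1 1 - t * A.1 0 1 ≠ 0 := by
      intro h0
      have h3 : A.1 1 0 = t * A.1 0 0 := by linear_combination hq - u * h0
      rw [h3] at hd
      have : (0 : ℝ) = 1 := by linear_combination hd - A.1 0 0 * h0
      exact zero_ne_one this
    have e : u = (t * A.1 0 0 - A.1 1 0) / (A.1 1 1 - t * A.1 0 1) := by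
      rw [eq_div_iff hne]
      linear_combination hq
    rw [e]
    exact div_mem (sub_mem (mul_mem htK (hA 0 0)) (hA 1 0))
      (sub_mem (hA 1 1) (mul_mem htK (hA 0 1)))
  omega

/-- Conjugating the hyperbolic product by the initial word gives a hyperbolic element of the Veech
group that fixes the given direction. -/
theorem IsImageOfHyperbolicEigendirection.exists_mem_veechGroup {n : ℕ} {θ : Direction}
    (h : IsImageOfHyperbolicEigendirection n θ) :
    ∃ A ∈ veechGroup n, IsHyperbolic A ∧ A • θ = θ := by
  obtain ⟨I, J, η, hJ, hη, rfl⟩ := h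
  refine ⟨wordProd n I * wordProd n J * (wordProd n I)⁻¹,
    mul_mem (mul_mem (wordProd_mem_veechGroup I) (wordProd_mem_veechGroup J))
      (inv_mem (wordProd_mem_veechGroup I)), ?_, ?_⟩
  · rw [IsHyperbolic, Matrix.SpecialLinearGroup.coe_mul, Matrix.trace_mul_comm,
      ← Matrix.SpecialLinearGroup.coe_mul, inv_mul_cancel_left]
    exact hJ
  · rw [mul_smul, inv_smul_smul, mul_smul, hη]

end DoublePolygon

end

theorem theorem1 (n : ℕ) (hn : 1 ≤ n) :
    (∀ (θ : DoublePolygon.Direction) (t : ℝ), 0 < t → DoublePolygon.HasSlope θ t →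
      t ∈ DoublePolygon.traceField n →
      (DoublePolygon.EndsWithPeriodGeTwo n θ ↔
        DoublePolygon.IsImageOfHyperbolicEigendirection n θ) ∧
      (DoublePolygon.IsEventuallyPeriodic n θ ↔
        DoublePolygon.IsImageOfHyperbolicEigendirection n θ)) ∧
    (∀ (θ : DoublePolygon.Direction) (t : ℝ), 0 < t → DoublePolygon.HasSlope θ t →
      DoublePolygon.IsEventuallyPeriodic n θ ∨ DoublePolygon.EndsWithPeriodGeTwo n θ →
      ∃ A ∈ DoublePolygon.veechGroup n, DoublePolygon.IsHyperbolic A ∧ A • θ = θ) := by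
  constructor
  · intro θ t ht hθ htK
    obtain rfl := DoublePolygon.hasSlope_iff.1 hθ
    have hK := DoublePolygon.traceField_le_sideField hn htK
    exact ⟨⟨fun h => DoublePolygon.exists_hyperbolic_of_isEventuallyPeriodic hn ht.le
        (h.isEventuallyPeriodic hn),
      fun h => (h.isEventuallyPeriodic ht).endsWithPeriodGeTwo hn ht.le hK⟩,
      ⟨DoublePolygon.exists_hyperbolic_of_isEventuallyPeriodic hn ht.le,
      fun h => h.isEventuallyPeriodic ht⟩⟩
  · intro θ t ht hθ h
    obtain rfl := DoublePolygon.hasSlope_iff.1 hθ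
    exact (DoublePolygon.exists_hyperbolic_of_isEventuallyPeriodic hn ht.le
      (h.elim id fun h => h.isEventuallyPeriodic hn)).exists_mem_veechGroup
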